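/- Let $A=\{0,\dots,k-1\}$ be a finite alphabet and view a word $w\in A^*$ as the finite structure whose elements are the positions of $w$, with the linear order $<$ on positions and, for each letter $a\in A$, the unary predicate $P_a$ of the positions that carry $a$ (the empty word gives the empty structure). A first-order formula over this signature is $\Sigma_2(<)$ if pulling its quantifiers to the front puts it in a prenex form $\exists x_1\cdots\exists x_m\,\forall y_1\cdots\forall y_n\,\varphi$ with $\varphi$ quantifier-free, that is, if it is built by conjunctions, disjunctions and existential quantifications from quantifier-free formulas and from negations of formulas which are themselves built by conjunctions, disjunctions and existential quantifications from quantifier-free formulas and their negations. A formula is $\Pi_2(<)$ if it is the negation of a $\Sigma_2(<)$ formula. A language $L\subseteq A^*$ is $\Sigma_2(<)$-definable (resp. $\Pi_2(<)$-definable) if it is the set of words satisfying some $\Sigma_2(<)$ (resp. $\Pi_2(<)$) sentence. For languages $L_1,L_2\subseteq A^*$ say that $L_1$ is $\Sigma_2(<)$-separable (resp. $\Pi_2(<)$-separable) from $L_2$ if there is a $\Sigma_2(<)$-definable (resp. $\Pi_2(<)$-definable) language $L$ with $L_1\subseteq L$ and $L\cap L_2=\emptyset$. Then both of the following problems are decidable: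 given $k$ and two regular languages $L_1,L_2\subseteq A^*$, each presented by a nondeterministic finite automaton, (1) is $L_1$ $\Sigma_2(<)$-separable from $L_2$? (2) is $L_1$ $\Pi_2(<)$-separable from $L_2$? -/

import Mathlib

/-! ### First-order logic over words -/

/-- The relation symbols of `FO(<)` over the alphabet `A`: a unary predicate `P_a` for every letter
`a`, and the binary symbol `<`. -/
inductive WordRel (A : Type) : ℕ → Type
  | letter (a : A) : WordRel A 1
  | lt : WordRel A 2

/-- The signature of `FO(<)` over the alphabet `A` (no function symbols; equality is logical). -/
def wordSig (A : Type) : FirstOrder.Language := ⟨fun _ => Empty, WordRel A⟩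

/-- A word, seen as the logical structure of its positions `0, …, |w| - 1` (there is none if
`w` is empty): `P_a x` says that the letter at position `x` is `a`, and `<` is the usual order. -/
@[reducible] def wordStructure {A : Type} (w : List A) : (wordSig A).Structure (Fin w.length) where
  funMap := fun f => Empty.elim f
  RelMap := fun {n} (r : WordRel A n) =>
    match n, r with
    | _, WordRel.letter a => fun x => w.get (x 0) = a
    | _, WordRel.lt => fun x => x 0 < x 1

/-- The language defined by a sentence of `FO(<)`: the set of the words that satisfy it. -/
def languageOf {A : Type} (φ : (wordSig A).Sentence) : Language A :=
  {w | @FirstOrder.Language.Sentence.Realize (wordSig A) (Fin w.length) (wordStructure w) φ}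

/-- `IsSigma i φ`: the formula `φ` is `Σ_i`, that is, pulling its quantifiers to the front gives a
prenex formula with (at most) `i` blocks of quantifiers, the first of them existential. This is
the least family of classes of formulas such that quantifier-free formulas are in every class,
negations of `Σ_i` formulas (that is, `Π_i` formulas) are `Σ_{i+1}`, every class is closed under
conjunction and disjunction, and every class of level at least one is closed under `∃`.
The blocks are counted on formulas that need not be prenex themselves, because the
empty word is a structure without elements, on which pulling out quantifiers changes the meaning of
a formula (`∃ x, φ` is false there and `∀ x, φ` is true, whatever `φ` is). On nonempty words these
formulas define the same languages as the prenex ones. -/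
inductive IsSigma {A : Type} :
    ℕ → ∀ {n : ℕ}, (wordSig A).BoundedFormula Empty n → Prop
  | qf {i n : ℕ} {φ : (wordSig A).BoundedFormula Empty n} : φ.IsQF → IsSigma i φ
  | not {i n : ℕ} {φ : (wordSig A).BoundedFormula Empty n} :
      IsSigma i φ → IsSigma (i + 1) φ.not
  | inf {i n : ℕ} {φ ψ : (wordSig A).BoundedFormula Empty n} :
      IsSigma i φ → IsSigma i ψ → IsSigma i (φ ⊓ ψ)
  | sup {i n : ℕ} {φ ψ : (wordSig A).BoundedFormula Empty n} :
      IsSigma i φ → IsSigma i ψ → IsSigma i (φ ⊔ ψ)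
  | ex {i n : ℕ} {φ : (wordSig A).BoundedFormula Empty (n + 1)} :
      IsSigma (i + 1) φ → IsSigma (i + 1) φ.ex

/-- A `Π_i` formula is the negation of a `Σ_i` formula. -/
def IsPi {A : Type} (i : ℕ) {n : ℕ} (φ : (wordSig A).BoundedFormula Empty n) : Prop :=
  ∃ ψ : (wordSig A).BoundedFormula Empty n, IsSigma i ψ ∧ φ = ψ.not

/-- The class of the languages over `A` that are definable by a `Σ_i(<)` sentence. -/
def SigmaClass (A : Type) (i : ℕ) : Set (Language A) :=
  {L | ∃ φ : (wordSig A).Sentence, IsSigma i φ ∧ L = languageOf φ}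

/-- The class of the languages over `A` that are definable by a `Π_i(<)` sentence. -/
def PiClass (A : Type) (i : ℕ) : Set (Language A) :=
  {L | ∃ φ : (wordSig A).Sentence, IsPi i φ ∧ L = languageOf φ}

/-! ### Separation -/

/-- `L₀` is `X`-separable from `L₁`: some language of the class `X` contains `L₀` and is disjoint
from `L₁`. -/
def Separable {A : Type} (X : Set (Language A)) (L₀ L₁ : Language A) : Prop :=
  ∃ L ∈ X, (∀ w ∈ L₀, w ∈ L) ∧ ∀ w ∈ L₁, w ∉ L

/-! ### Finite automata as inputs of algorithms -/

/-- The finite description `(n, Δ, I, F)` of a nondeterministic finite automaton: the number `n` of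
its states `0, …, n - 1`, the list `Δ` of its transitions `(q, a, q')`, the list `I` of its
initial states, and the list `F` of its final states. Letters are numbers too. -/
abbrev NFACode : Type := ℕ × List (ℕ × ℕ × ℕ) × List ℕ × List ℕ

/-- The automaton over the alphabet `{0, …, k - 1}` with the description `c` (entries of the lists
that are out of range are ignored). -/
def NFACode.toNFA (k : ℕ) (c : NFACode) : NFA (Fin k) (Fin c.1) where
  step := fun q a => {q' | ((q : ℕ), (a : ℕ), (q' : ℕ)) ∈ c.2.1}
  start := {q | (q : ℕ) ∈ c.2.2.1}
  accept := {q | (q : ℕ) ∈ c.2.2.2}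

/-- The language over the alphabet `{0, …, k - 1}` of the automaton described by `c`. -/
def NFACode.language (k : ℕ) (c : NFACode) : Language (Fin k) := (c.toNFA k).accepts

/-- Exactly the regular languages have a description. -/
theorem NFACode.exists_language_eq_iff {k : ℕ} (L : Language (Fin k)) :
    (∃ c : NFACode, c.language k = L) ↔ L.IsRegular := by
  classical
  constructor
  · rintro ⟨c, rfl⟩
    exact ⟨_, inferInstance, (c.toNFA k).toDFA, NFA.toDFA_correct⟩
  · rintro ⟨σ, _, M, rfl⟩
    let e := Fintype.equivFin σ
    let N : NFA (Fin k) (Fin (Fintype.card σ)) := ((DFA.reindex e) M).toNFA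
    let Δ : List (ℕ × ℕ × ℕ) :=
      ((Finset.univ : Finset (Fin (Fintype.card σ) × Fin k × Fin (Fintype.card σ))).filter
        (fun t => t.2.2 ∈ N.step t.1 t.2.1)).toList.map
        (fun t => ((t.1 : ℕ), (t.2.1 : ℕ), (t.2.2 : ℕ)))
    let I : List ℕ := ((Finset.univ : Finset (Fin (Fintype.card σ))).filter
      (fun q => q ∈ N.start)).toList.map (fun q => (q : ℕ))
    let F : List ℕ := ((Finset.univ : Finset (Fin (Fintype.card σ))).filter
      (fun q => q ∈ N.accept)).toList.map (fun q => (q : ℕ))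
    refine ⟨(Fintype.card σ, Δ, I, F), ?_⟩
    have hext : ∀ M₁ M₂ : NFA (Fin k) (Fin (Fintype.card σ)), M₁.step = M₂.step →
        M₁.start = M₂.start → M₁.accept = M₂.accept → M₁ = M₂ := by
      rintro ⟨_, _, _⟩ ⟨_, _, _⟩ h1 h2 h3
      cases h1; cases h2; cases h3; rfl
    have h : NFACode.toNFA k (Fintype.card σ, Δ, I, F) = N := by
      have h1 : (NFACode.toNFA k (Fintype.card σ, Δ, I, F)).step = N.step := by
        funext q a
        ext q'
        simp only [NFACode.toNFA, Set.mem_ofPred_eq, Δ, List.mem_map, Finset.mem_toList,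
          Finset.mem_filter, Finset.mem_univ, true_and, Prod.exists, Prod.mk.injEq]
        constructor
        · rintro ⟨x, y, z, hm, hx, hy, hz⟩
          rwa [Fin.ext hx, Fin.ext hy, Fin.ext hz] at hm
        · intro hm
          exact ⟨q, a, q', hm, rfl, rfl, rfl⟩
      have h2 : (NFACode.toNFA k (Fintype.card σ, Δ, I, F)).start = N.start := by
        ext q
        simp [NFACode.toNFA, I, Fin.val_inj]
      have h3 : (NFACode.toNFA k (Fintype.card σ, Δ, I, F)).accept = N.accept := by
        ext q
        simp [NFACode.toNFA, F, Fin.val_inj]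
      exact hext _ _ h1 h2 h3
    rw [NFACode.language, h, DFA.toNFA_correct, DFA.accepts_reindex]

/-! The approach is to compute, for all words `w` at once, what `w` can reveal to a `Σ₂` sentence.
Attach to `w` the relation it induces on the states of the first automaton `M`, its alphabet, and a
set of state pairs of the second automaton `N` that are joined by words which `Σ₂` sentences of a
given size cannot tell apart from `w` in the upward direction. Such profiles form a finite monoid.
`Saturated` is the least submonoid that contains the letters and is closed under one operation: for
an idempotent `e` with alphabet `B`, replace its right component `r` by `r · B* · r`. Then
`M.accepts` is `Σ₂`-separable from `N.accepts` iff no saturated profile is accepting on both sides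
(`separable_sigma_iff`).

An accepting profile rules out separation: every `Σ₂` language is upward closed for some preorder
`WordLE n n` (`exists_wordLE_of_mem_sigmaClass`), and every saturated profile is realized, for all
`n` and `m`, by a word `w` and words of `N` above `w` (`Saturated.exists_word`). The saturation step
is sound because arbitrary words over the alphabet of `u` may be inserted between high powers of `u`
(`wordLE_pump`).

Conversely, every word lies in a monomial `B₀* a₁ B₁* ⋯` of bounded length whose words have only
runs of `N` allowed by a saturated profile of the word (`exists_forall_hasMonomial`). This is a
factorization argument by induction on the size of two-sided ideals: long stretches that stay within
one level collapse to their first factor, a `B*`, and their last factor (`HasMonomial.block`).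
Monomials are `Σ₂`-definable and only finitely many have bounded length, so the union of those
disjoint from `N.accepts` is a separator if no saturated profile is accepting.

The criterion concerns the least closed subset of a finite set. With finite sets coded by the binary
digits of numbers, it becomes a formula with bounded quantifiers, hence primitive recursive. The
`Π₂` problem is the `Σ₂` problem with the two languages exchanged. -/

/-! ### Runs of automata -/

/-- `M.Run w p q`: some run of `M` on the word `w` leads from the state `p` to the state `q`. -/
def NFA.Run {A σ : Type} (M : NFA A σ) : List A → σ → σ → Prop
  | [], p, q => p = q
  | a :: w, p, q => ∃ r, r ∈ M.step p a ∧ NFA.Run M w r q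

theorem NFA.run_append {A σ : Type} (M : NFA A σ) (u v : List A) :
    M.Run (u ++ v) = Relation.Comp (M.Run u) (M.Run v) := by
  funext p q
  induction u generalizing p with
  | nil => simp [NFA.Run, Relation.Comp]
  | cons a u ih =>
    simp only [List.cons_append, NFA.Run, ih, Relation.Comp, eq_iff_iff]
    grind

theorem NFA.mem_evalFrom_iff_run {A σ : Type} (M : NFA A σ) (w : List A) (S : Set σ) (q : σ) :
    q ∈ M.evalFrom S w ↔ ∃ p ∈ S, M.Run w p q := by
  induction w generalizing S with
  | nil => simp [NFA.Run]
  | cons a w ih =>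
    rw [NFA.evalFrom_cons, ih]
    simp only [NFA.mem_stepSet, NFA.Run]
    grind

theorem NFA.mem_accepts_iff_run {A σ : Type} (M : NFA A σ) (w : List A) :
    w ∈ M.accepts ↔ ∃ p ∈ M.start, ∃ q ∈ M.accept, M.Run w p q := by
  simp only [NFA.mem_accepts, NFA.mem_evalFrom_iff_run]
  grind

/-- `M.Reach B p q`: some word over the alphabet `B` leads from `p` to `q`. -/
def NFA.Reach {A σ : Type} (M : NFA A σ) (B : Set A) (p q : σ) : Prop :=
  ∃ u : List A, (∀ a ∈ u, a ∈ B) ∧ M.Run u p q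

theorem NFA.Reach.trans {A σ : Type} {M : NFA A σ} {B : Set A} {p q r : σ}
    (h : M.Reach B p q) (h' : M.Reach B q r) : M.Reach B p r := by
  obtain ⟨u, hu, hr⟩ := h
  obtain ⟨v, hv, hs⟩ := h'
  refine ⟨u ++ v, by grind, ?_⟩
  rw [NFA.run_append]
  exact ⟨q, hr, hs⟩

theorem NFA.Reach.mono {A σ : Type} {M : NFA A σ} {B C : Set A} (hBC : B ⊆ C) {p q : σ}
    (h : M.Reach B p q) : M.Reach C p q := by
  obtain ⟨u, hu, hr⟩ := h
  exact ⟨u, fun a ha => hBC (hu a ha), hr⟩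

/-- The set of the letters of a word. -/
def alph {A : Type} (w : List A) : Set A := {a | a ∈ w}

@[simp] theorem mem_alph {A : Type} {w : List A} {a : A} : a ∈ alph w ↔ a ∈ w := Iff.rfl

theorem alph_append {A : Type} (u v : List A) : alph (u ++ v) = alph u ∪ alph v := by
  ext a; simp

/-! ### Profiles -/

/-- A profile of words: a relation between the states of one automaton, a set of letters, and a
relation between the states of another automaton. -/
@[ext] structure Profile (A σ τ : Type) where
  left : σ → σ → Prop
  letters : Set A
  right : τ → τ → Prop

namespace Profile

variable {A σ τ : Type}

instance : Mul (Profile A σ τ) where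
  mul x y := ⟨Relation.Comp x.left y.left, x.letters ∪ y.letters, Relation.Comp x.right y.right⟩

instance : One (Profile A σ τ) where
  one := ⟨Eq, ∅, Eq⟩

@[simp] theorem mul_left' (x y : Profile A σ τ) : (x * y).left = Relation.Comp x.left y.left := rfl
@[simp] theorem mul_letters (x y : Profile A σ τ) :
    (x * y).letters = x.letters ∪ y.letters := rfl
@[simp] theorem mul_right' (x y : Profile A σ τ) :
    (x * y).right = Relation.Comp x.right y.right := rfl
@[simp] theorem one_left : (1 : Profile A σ τ).left = Eq := rfl
@[simp] theorem one_letters : (1 : Profile A σ τ).letters = ∅ := rfl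
@[simp] theorem one_right : (1 : Profile A σ τ).right = Eq := rfl

instance : Monoid (Profile A σ τ) where
  mul_assoc x y z := by
    ext1 <;> simp [Relation.comp_assoc, Set.union_assoc]
  one_mul x := by
    ext1 <;> simp [Relation.eq_comp]
  mul_one x := by
    ext1 <;> simp [Relation.comp_eq]

instance [Finite A] [Finite σ] [Finite τ] : Finite (Profile A σ τ) :=
  Finite.of_injective (β := (σ → σ → Prop) × Set A × (τ → τ → Prop))
    (fun x => (x.left, x.letters, x.right)) (by
      intro x y h
      simp only [Prod.mk.injEq] at h
      exact Profile.ext h.1 h.2.1 h.2.2)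

/-- The profile of a letter. -/
def ofLetter (M : NFA A σ) (N : NFA A τ) (a : A) : Profile A σ τ :=
  ⟨M.Run [a], {a}, N.Run [a]⟩

/-- Insert arbitrary words over the alphabet of a profile into its right component. -/
def saturate (N : NFA A τ) (x : Profile A σ τ) : Profile A σ τ :=
  ⟨x.left, x.letters, Relation.Comp x.right (Relation.Comp (N.Reach x.letters) x.right)⟩

end Profile

/-- The least submonoid of profiles that contains the profiles of letters and is closed under the
saturation of idempotents. -/
inductive Saturated {A σ τ : Type} (M : NFA A σ) (N : NFA A τ) : Profile A σ τ → Prop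
  | one : Saturated M N 1
  | letter (a : A) : Saturated M N (Profile.ofLetter M N a)
  | mul {x y : Profile A σ τ} : Saturated M N x → Saturated M N y → Saturated M N (x * y)
  | saturate {x : Profile A σ τ} : Saturated M N x → x * x = x → Saturated M N (x.saturate N)

/-- Saturation only inserts words over the alphabet already present. In `HasMonomial.block` this
lets a run through a saturated factor be absorbed into a neighbouring `B*`. -/
theorem Saturated.right_le {A σ τ : Type} {M : NFA A σ} {N : NFA A τ} {x : Profile A σ τ}
    (h : Saturated M N x) {p q : τ} (hpq : x.right p q) : N.Reach x.letters p q := by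
  induction h generalizing p q with
  | one => exact ⟨[], by simp, hpq⟩
  | letter a => exact ⟨[a], by simp [Profile.ofLetter], hpq⟩
  | mul _ _ ihx ihy =>
    obtain ⟨r, h1, h2⟩ := hpq
    exact ((ihx h1).mono Set.subset_union_left).trans ((ihy h2).mono Set.subset_union_right)
  | saturate _ _ ih =>
    obtain ⟨r, h1, s, h2, h3⟩ := hpq
    exact ((ih h1).trans h2).trans (ih h3)

/-! ### A preorder on words -/

/-- The words of length at most `n` that are scattered subwords of `v'` are scattered subwords
of `v`. -/
def SubwordLE {A : Type} (n : ℕ) (v v' : List A) : Prop :=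
  ∀ s : List A, s.length ≤ n → s.Sublist v' → s.Sublist v

theorem SubwordLE.refl {A : Type} (n : ℕ) (v : List A) : SubwordLE n v v := fun _ _ h => h

theorem SubwordLE.trans {A : Type} {n : ℕ} {u v w : List A} (h : SubwordLE n u v)
    (h' : SubwordLE n v w) : SubwordLE n u w := fun s hs hw => h s hs (h' s hs hw)

theorem SubwordLE.append {A : Type} {n : ℕ} {u u' v v' : List A} (h : SubwordLE n u u')
    (h' : SubwordLE n v v') : SubwordLE n (u ++ v) (u' ++ v') := by
  intro s hs hsub
  obtain ⟨s1, s2, rfl, h1, h2⟩ := List.sublist_append_iff.1 hsub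
  simp only [List.length_append] at hs
  exact (h s1 (by omega) h1).append (h' s2 (by omega) h2)

/-- Every choice of at most `m` positions of `w` has a counterpart in `w'`, with the same letters,
such that every factor of `w'` between chosen positions has no scattered subwords of length at most
`n` that the factor of `w` does not have. -/
def WordLE {A : Type} (n : ℕ) : ℕ → List A → List A → Prop
  | 0, w, w' => SubwordLE n w w'
  | m + 1, w, w' => SubwordLE n w w' ∧ ∀ g a r, w = g ++ a :: r →
      ∃ g' r', w' = g' ++ a :: r' ∧ SubwordLE n g g' ∧ WordLE n m r r'

namespace WordLE

variable {A : Type} {n m : ℕ}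

theorem subwordLE {w w' : List A} (h : WordLE n m w w') : SubwordLE n w w' := by
  cases m with
  | zero => exact h
  | succ m => exact h.1

theorem of_succ {w w' : List A} (h : WordLE n (m + 1) w w') : WordLE n m w w' := by
  induction m generalizing w w' with
  | zero => exact h.1
  | succ m ih =>
    refine ⟨h.1, fun g a r hw => ?_⟩
    obtain ⟨g', r', h1, h2, h3⟩ := h.2 g a r hw
    exact ⟨g', r', h1, h2, ih h3⟩

theorem refl (w : List A) : WordLE n m w w := by
  induction m generalizing w with
  | zero => exact SubwordLE.refl n w
  | succ m ih => exact ⟨SubwordLE.refl n w, fun g a r hw => ⟨g, r, hw, SubwordLE.refl n g, ih r⟩⟩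

theorem trans {u v w : List A} (h : WordLE n m u v) (h' : WordLE n m v w) : WordLE n m u w := by
  induction m generalizing u v w with
  | zero => exact SubwordLE.trans h h'
  | succ m ih =>
    refine ⟨h.1.trans h'.1, fun g a r hu => ?_⟩
    obtain ⟨g', r', h1, h2, h3⟩ := h.2 g a r hu
    obtain ⟨g'', r'', k1, k2, k3⟩ := h'.2 g' a r' h1
    exact ⟨g'', r'', k1, h2.trans k2, ih h3 k3⟩

/-- A chosen position lies either in `u` or in `v`, and its counterpart is found in the same half.
Compatibility with concatenation is what makes witnesses of profiles multiply. -/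
theorem append {u u' v v' : List A} (h : WordLE n m u u') (h' : WordLE n m v v') :
    WordLE n m (u ++ v) (u' ++ v') := by
  induction m generalizing u u' v v' with
  | zero => exact SubwordLE.append h h'
  | succ m ih =>
    refine ⟨h.1.append h'.1, fun g a r huv => ?_⟩
    rcases List.append_eq_append_iff.1 huv with ⟨b, rfl, h2⟩ | ⟨b, rfl, h2⟩
    · obtain ⟨g', r', rfl, k2, k3⟩ := h'.2 b a r h2
      exact ⟨u' ++ g', r', by simp, h.1.append k2, k3⟩
    · cases b with
      | nil =>
        simp only [List.nil_append] at h2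
        obtain ⟨g', r', rfl, k2, k3⟩ := h'.2 [] a r h2.symm
        refine ⟨u' ++ g', r', by simp, ?_, k3⟩
        have := h.1.append k2
        simpa using this
      | cons c b =>
        simp only [List.cons_append, List.cons.injEq] at h2
        obtain ⟨rfl, rfl⟩ := h2
        obtain ⟨g', r', rfl, k2, k3⟩ := h.2 g a b rfl
        exact ⟨g', r' ++ v', by simp, k2, ih k3 h'.of_succ⟩

end WordLE

/-- The `j`-th power of a word. -/
def wordPow {A : Type} (u : List A) : ℕ → List A
  | 0 => []
  | j + 1 => u ++ wordPow u j

theorem alph_wordPow {A : Type} (u : List A) (j : ℕ) : alph (wordPow u (j + 1)) = alph u := by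
  induction j with
  | zero => simp [wordPow]
  | succ j ih => rw [wordPow, alph_append, ih, Set.union_self]

theorem mem_of_mem_wordPow {A : Type} {u : List A} {j : ℕ} {a : A} (h : a ∈ wordPow u j) :
    a ∈ u := by
  cases j with
  | zero => simp [wordPow] at h
  | succ j => rw [← mem_alph, ← alph_wordPow u j]; exact h

/-- Each letter of `s` is taken from its own copy of `u`. -/
theorem sublist_wordPow {A : Type} (u s : List A) (j : ℕ) (hs : s.length ≤ j)
    (h : ∀ a ∈ s, a ∈ u) : s.Sublist (wordPow u j) := by
  induction j generalizing s with
  | zero =>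
    obtain rfl : s = [] := by simpa using hs
    simp
  | succ j ih =>
    cases s with
    | nil => simp
    | cons a s =>
      have h1 : [a].Sublist u := by simpa using h a (by simp)
      exact h1.append (ih s (by simpa using hs) fun b hb => h b (by simp [hb]))

/-- If `u` has all words of length at most `n` over its alphabet as scattered subwords, then high
powers of `u` may be replaced by words over its alphabet that start and end with such powers. -/
theorem wordLE_pump {A : Type} {n : ℕ} {u : List A}
    (hu : ∀ s : List A, s.length ≤ n → (∀ a ∈ s, a ∈ u) → s.Sublist u) (m j : ℕ) (hj : m + 1 ≤ j)
    (z : List A) (hz : ∀ a ∈ z, a ∈ u) :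
    WordLE n m (wordPow u j) (wordPow u j ++ z ++ wordPow u j) := by
  -- A factor that contains a whole copy of `u` already has every short subword over the alphabet,
  -- so it dominates any word over that alphabet.
  have huniv : ∀ v v' : List A, (∀ a ∈ v', a ∈ u) → SubwordLE n (u ++ v) v' :=
    fun v v' hv' s hs hsub => (hu s hs fun a ha => hv' a (hsub.subset ha)).trans (List.sublist_append_left u v)
  have hword : ∀ z : List A, (∀ a ∈ z, a ∈ u) → ∀ i,
      ∀ a ∈ wordPow u i ++ z ++ wordPow u i, a ∈ u := by
    intro z hz i a ha
    simp only [List.mem_append] at ha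
    rcases ha with (ha | ha) | ha
    · exact mem_of_mem_wordPow ha
    · exact hz a ha
    · exact mem_of_mem_wordPow ha
  induction m generalizing j z with
  | zero =>
    obtain ⟨i, rfl⟩ : ∃ i, j = i + 1 := ⟨j - 1, by omega⟩
    exact huniv _ _ (hword z hz _)
  | succ m ih =>
    obtain ⟨i, rfl⟩ : ∃ i, j = i + 1 := ⟨j - 1, by omega⟩
    refine ⟨huniv _ _ (hword z hz _), fun g a r hw => ?_⟩
    -- A position beyond the first copy of `u` is matched in the final power, with the same
    -- remainder `r`. The gap before it may be anything, since `g` contains `u`.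
    have key : ∀ b, u ++ b = g → ∃ g' r',
        wordPow u (i + 1) ++ z ++ wordPow u (i + 1) = g' ++ a :: r' ∧
        SubwordLE n g g' ∧ WordLE n m r r' := by
      rintro b rfl
      refine ⟨wordPow u (i + 1) ++ z ++ (u ++ b), r, by rw [hw]; simp, ?_, WordLE.refl r⟩
      refine huniv b _ fun c hc => ?_
      simp only [List.mem_append] at hc
      rcases hc with (hc | hc) | hc | hc
      · exact mem_of_mem_wordPow hc
      · exact hz c hc
      · exact hc
      · refine mem_of_mem_wordPow (j := i + 1) ?_
        rw [hw]; simp [hc]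
    rcases List.append_eq_append_iff.1 hw with ⟨b, hb, h2⟩ | ⟨b, hb, h2⟩
    · exact key b hb.symm
    · cases b with
      | nil => exact key [] (by simpa using hb)
      | cons c b =>
        simp only [List.cons_append, List.cons.injEq] at h2
        obtain ⟨rfl, rfl⟩ := h2
        -- A position inside the first copy stays where it is. The rest has one power less on the
        -- left, and a copy of `u` moves from the right power into `z`; hence one power is spent per
        -- chosen position.
        refine ⟨g, b ++ wordPow u i ++ z ++ wordPow u (i + 1), by simp [wordPow, hb],
          SubwordLE.refl n g, ?_⟩
        have := (WordLE.refl (n := n) (m := m) b).append (ih i (by omega) (z ++ u) (by grind))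
        simpa [wordPow] using this

/-! ### Saturated profiles are witnessed by words -/

/-- Soundness of the rules. Only saturation needs an idea: an idempotent profile is shared by all
positive powers of its witness, and in a high enough power `wordLE_pump` allows the insertion. -/
theorem Saturated.exists_word {A σ τ : Type} {M : NFA A σ} {N : NFA A τ} {x : Profile A σ τ}
    (h : Saturated M N x) (n m : ℕ) : ∃ w : List A, M.Run w = x.left ∧ alph w = x.letters ∧
      ∀ p q, x.right p q → ∃ w', WordLE n m w w' ∧ N.Run w' p q := by
  induction h with
  | one =>
    refine ⟨[], rfl, by simp [alph], fun p q hpq => ⟨[], WordLE.refl _, hpq⟩⟩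
  | letter a =>
    refine ⟨[a], rfl, by ext; simp [Profile.ofLetter], fun p q hpq => ⟨[a], WordLE.refl _, hpq⟩⟩
  | mul _ _ ihx ihy =>
    obtain ⟨u, hu1, hu2, hu3⟩ := ihx
    obtain ⟨v, hv1, hv2, hv3⟩ := ihy
    refine ⟨u ++ v, by rw [NFA.run_append, hu1, hv1]; rfl, by rw [alph_append, hu2, hv2]; rfl, ?_⟩
    rintro p q ⟨r, hpr, hrq⟩
    obtain ⟨u', hu', hr⟩ := hu3 p r hpr
    obtain ⟨v', hv', hs⟩ := hv3 r q hrq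
    exact ⟨u' ++ v', hu'.append hv', by rw [NFA.run_append]; exact ⟨r, hr, hs⟩⟩
  | @saturate x _ hidem ih =>
    obtain ⟨u, hu1, hu2, hu3⟩ := ih
    have hpow : ∀ v : List A, (M.Run v = x.left ∧ alph v = x.letters ∧
        ∀ p q, x.right p q → ∃ w', WordLE n m v w' ∧ N.Run w' p q) → ∀ j,
        M.Run (wordPow v (j + 1)) = x.left ∧ alph (wordPow v (j + 1)) = x.letters ∧
        ∀ p q, x.right p q → ∃ w', WordLE n m (wordPow v (j + 1)) w' ∧ N.Run w' p q := by
      rintro v ⟨hv1, hv2, hv3⟩ j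
      refine ⟨?_, by rw [alph_wordPow, hv2], ?_⟩
      · induction j with
        | zero => simpa [wordPow] using hv1
        | succ j ih =>
          rw [wordPow, NFA.run_append, ih, hv1]
          exact congrArg Profile.left hidem
      · induction j with
        | zero => simpa [wordPow] using hv3
        | succ j ih =>
          intro p q hpq
          rw [← hidem] at hpq
          obtain ⟨r, hpr, hrq⟩ := hpq
          obtain ⟨u', hu', hr⟩ := hv3 p r hpr
          obtain ⟨v', hv', hs⟩ := ih r q hrq
          exact ⟨u' ++ v', hu'.append hv', by rw [NFA.run_append]; exact ⟨r, hr, hs⟩⟩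
    -- The power `n + 1` contains all words of length at most `n` over its alphabet; the further
    -- power `m + 1` is the exponent that `wordLE_pump` requires.
    have h1 := hpow u ⟨hu1, hu2, hu3⟩ n
    have h2 := hpow _ h1 m
    refine ⟨_, h2.1, h2.2.1, ?_⟩
    rintro p q ⟨r, hpr, s, ⟨z, hz, hrs⟩, hsq⟩
    obtain ⟨v, hv, hv'⟩ := h2.2.2 p r hpr
    obtain ⟨w, hw, hw'⟩ := h2.2.2 s q hsq
    refine ⟨v ++ z ++ w, ?_, ?_⟩
    · refine (wordLE_pump ?_ m _ le_rfl z ?_).trans ((hv.append (WordLE.refl z)).append hw)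
      · intro t ht hmem
        exact sublist_wordPow u t (n + 1) (by omega) fun a ha => mem_of_mem_wordPow (hmem a ha)
      · intro a ha
        rw [← mem_alph, h1.2.1]
        exact hz a ha
    · rw [NFA.run_append, NFA.run_append]
      exact ⟨s, ⟨r, hv', hrs⟩, hw'⟩

/-! ### The order of two-sided ideals of a finite monoid -/

/-- The cardinality of the two-sided ideal generated by `x`. -/
noncomputable def idealCard {S : Type} [Monoid S] (x : S) : ℕ :=
  {y : S | ∃ a b, y = a * x * b}.ncard

section IdealCard

variable {S : Type} [Monoid S] [Finite S]

theorem idealCard_mul_le (a x b : S) : idealCard (a * x * b) ≤ idealCard x := by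
  refine Set.ncard_le_ncard ?_ (Set.toFinite _)
  rintro y ⟨c, d, rfl⟩
  exact ⟨c * a, b * d, by simp only [mul_assoc]⟩

theorem idealCard_mul_le_left (x b : S) : idealCard (x * b) ≤ idealCard x := by
  simpa using idealCard_mul_le 1 x b

theorem idealCard_mul_le_right (a x : S) : idealCard (a * x) ≤ idealCard x := by
  simpa using idealCard_mul_le a x 1

theorem idealCard_pos (x : S) : 0 < idealCard x :=
  (Set.ncard_pos (Set.toFinite _)).2 ⟨x, 1, 1, by simp⟩

theorem idealCard_le_card (x : S) : idealCard x ≤ Nat.card S := by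
  rw [← Set.ncard_univ]
  exact Set.ncard_le_ncard (Set.subset_univ _) (Set.toFinite _)

theorem exists_pow_idempotent (x : S) : ∃ j, x ^ (j + 1) * x ^ (j + 1) = x ^ (j + 1) := by
  obtain ⟨i, j, hij, h⟩ : ∃ i j : ℕ, i < j ∧ x ^ i = x ^ j := by
    obtain ⟨i, j, hne, h⟩ := Finite.exists_ne_map_eq_of_infinite (fun n : ℕ => x ^ n)
    rcases lt_or_gt_of_ne hne with hl | hl
    · exact ⟨i, j, hl, h⟩
    · exact ⟨j, i, hl, h.symm⟩
  obtain ⟨d, rfl⟩ : ∃ d, j = i + (d + 1) := ⟨j - i - 1, by omega⟩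
  have hper : ∀ k, i ≤ k → ∀ c, x ^ (k + c * (d + 1)) = x ^ k := by
    intro k hk c
    obtain ⟨l, rfl⟩ : ∃ l, k = i + l := ⟨k - i, by omega⟩
    induction c with
    | zero => simp
    | succ c ih =>
      rw [show i + l + (c + 1) * (d + 1) = (i + (d + 1)) + (l + c * (d + 1)) by ring, pow_add, ← h,
        ← pow_add, ← add_assoc, ih]
  -- The exponent `(i + 1) * (d + 1)` is a positive multiple of the period `d + 1` and at least the
  -- preperiod `i`.
  refine ⟨(i + 1) * (d + 1) - 1, ?_⟩
  have h1 : (i + 1) * (d + 1) - 1 + 1 = (i + 1) * (d + 1) :=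
    Nat.sub_add_cancel (Nat.succ_le_of_lt (by positivity))
  rw [h1, ← pow_add]
  exact hper _ (by nlinarith) _

/-- Stability of finite monoids: the ideals coincide, so `x = a * x * (y * b)`. Iterating this up to
an idempotent power of `y * b` removes the left factor. -/
theorem exists_eq_mul_mul_of_idealCard_eq {x y : S} (h : idealCard (x * y) = idealCard x) :
    ∃ z, x = x * y * z := by
  have hsub : {t : S | ∃ a b, t = a * (x * y) * b} ⊆ {t : S | ∃ a b, t = a * x * b} := by
    rintro t ⟨a, b, rfl⟩
    exact ⟨a, y * b, by simp only [mul_assoc]⟩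
  have heq := Set.eq_of_subset_of_ncard_le hsub h.ge (Set.toFinite _)
  obtain ⟨a, b, hab⟩ : x ∈ {t : S | ∃ a b, t = a * (x * y) * b} := heq ▸ ⟨1, 1, by simp⟩
  have hpow : ∀ n : ℕ, x = a ^ n * x * (y * b) ^ n := by
    intro n
    induction n with
    | zero => simp
    | succ n ih =>
      calc x = a * (x * y) * b := hab
        _ = a * x * (y * b) := by simp only [mul_assoc]
        _ = a * (a ^ n * x * (y * b) ^ n) * (y * b) := by rw [← ih]
        _ = a ^ (n + 1) * x * (y * b) ^ (n + 1) := by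
          rw [pow_succ' a, pow_succ (y * b)]; simp only [mul_assoc]
  obtain ⟨j, hj⟩ := exists_pow_idempotent (y * b)
  refine ⟨b * (y * b) ^ j, ?_⟩
  have h1 : x = x * (y * b) ^ (j + 1) := by
    conv_rhs => rw [hpow (j + 1), mul_assoc, hj, ← hpow (j + 1)]
  rw [pow_succ'] at h1
  simpa only [mul_assoc] using h1

theorem exists_eq_mul_mul_of_idealCard_eq' {x y : S} (h : idealCard (y * x) = idealCard x) :
    ∃ z, x = z * (y * x) := by
  have hsub : {t : S | ∃ a b, t = a * (y * x) * b} ⊆ {t : S | ∃ a b, t = a * x * b} := by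
    rintro t ⟨a, b, rfl⟩
    exact ⟨a * y, b, by simp only [mul_assoc]⟩
  have heq := Set.eq_of_subset_of_ncard_le hsub h.ge (Set.toFinite _)
  obtain ⟨a, b, hab⟩ : x ∈ {t : S | ∃ a b, t = a * (y * x) * b} := heq ▸ ⟨1, 1, by simp⟩
  have hpow : ∀ n : ℕ, x = (a * y) ^ n * x * b ^ n := by
    intro n
    induction n with
    | zero => simp
    | succ n ih =>
      calc x = a * (y * x) * b := hab
        _ = a * y * x * b := by simp only [mul_assoc]
        _ = a * y * ((a * y) ^ n * x * b ^ n) * b := by rw [← ih]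
        _ = (a * y) ^ (n + 1) * x * b ^ (n + 1) := by
          rw [pow_succ' (a * y), pow_succ b]; simp only [mul_assoc]
  obtain ⟨j, hj⟩ := exists_pow_idempotent (a * y)
  refine ⟨(a * y) ^ j * a, ?_⟩
  have h1 : x = (a * y) ^ (j + 1) * x := by
    conv_rhs => rw [hpow (j + 1), ← mul_assoc, ← mul_assoc, hj, ← hpow (j + 1)]
  rw [pow_succ] at h1
  simpa only [mul_assoc] using h1

end IdealCard

/-! ### Grouping factors -/

/-- The word is a concatenation of words that are related by `R n` to elements whose ideals have at
most `k` elements. -/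
inductive Factored {A S : Type} [Monoid S] (R : ℕ → List A → S → Prop) (k n : ℕ) : List A → Prop
  | nil : Factored R k n []
  | snoc {w v : List A} {x : S} : Factored R k n w → R n v x → idealCard x ≤ k →
      Factored R k n (w ++ v)

/-- Blocks: words that start and end with factors in the same class as their whole product. -/
def IsBlock {A S : Type} [Monoid S] (R : ℕ → List A → S → Prop) (k n : ℕ) (w : List A) : Prop :=
  ∃ (u v : List A) (x q y c d : S), w = u ++ v ∧ R n u x ∧ (∃ n', R n' v q) ∧
    idealCard x = k ∧ idealCard y = k ∧ idealCard (x * q) = k ∧ x * q = c * y ∧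
    R (2 * n + 1) w (d * y)

section Grouping

variable {A S : Type} [Monoid S] [Finite S] {R : ℕ → List A → S → Prop}

/-- Factors are read from left to right and gathered into a block as long as its product stays at
ideal size `k + 1`. When the product drops, the block and the factor causing the drop together form
a single factor of lower level, of cost `(2 * n + 1) + n = 3 * n + 1`. At most one unfinished block
remains at the end. -/
theorem Factored.exists_block (hone : ∀ n, R n [] 1)
    (hmono : ∀ {n m w x}, R n w x → n ≤ m → R m w x)
    (hmul : ∀ {n m w v x y}, R n w x → R m v y → R (n + m) (w ++ v) (x * y))
    (hblock : ∀ {n n' u v w x q y a b}, R n u x → R n' v q → R n w y →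
      x = x * (q * y) * a → y = b * (x * (q * y)) → ∃ d, R (2 * n + 1) (u ++ (v ++ w)) (d * y))
    {k n : ℕ} {w : List A} (h : Factored R (k + 1) n w) :
    ∃ u v, w = u ++ v ∧ Factored R k (3 * n + 1) u ∧ (v = [] ∨ IsBlock R (k + 1) n v) := by
  induction h with
  | nil => exact ⟨[], [], rfl, .nil, .inl rfl⟩
  | @snoc w z t _ hz ht ih =>
    obtain ⟨pre, blk, rfl, hpre, hblk⟩ := ih
    rcases hblk with rfl | ⟨u, v, x, q, y, c, d, rfl, hu, ⟨n', hv⟩, hx, hy, hxq, hc, hd⟩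
    · rcases Nat.lt_or_ge (idealCard t) (k + 1) with hlt | hge
      · exact ⟨pre ++ z, [], by simp, hpre.snoc (hmono hz (by omega)) (by omega), .inl rfl⟩
      · have hk : idealCard t = k + 1 := le_antisymm ht hge
        -- A single factor of top level opens a block in which it is both first and last.
        refine ⟨pre, z, by simp, hpre, .inr ⟨z, [], t, 1, t, 1, 1, by simp, hz, ⟨0, hone 0⟩, hk, hk,
          by simpa using hk, by simp, ?_⟩⟩
        rw [one_mul]
        exact hmono hz (by omega)
    · by_cases hk : idealCard (x * (q * t)) = k + 1
      · have htk : idealCard t = k + 1 := by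
          refine le_antisymm ht ?_
          rw [← hk, ← mul_assoc]
          exact idealCard_mul_le_right _ _
        -- The product has not dropped: its first factor can be recovered by multiplying on the
        -- right and its last by multiplying on the left, which is what `hblock` needs.
        obtain ⟨a, ha⟩ := exists_eq_mul_mul_of_idealCard_eq (hk.trans hx.symm)
        obtain ⟨b, hb⟩ : ∃ b, t = b * (x * (q * t)) := by
          rw [← mul_assoc] at hk ⊢
          exact exists_eq_mul_mul_of_idealCard_eq' (hk.trans htk.symm)
        obtain ⟨e, he⟩ := hblock hu hv hz ha hb
        refine ⟨pre, (u ++ v) ++ z, by simp, hpre, .inr ⟨u, v ++ z, x, q * t, t, x * q, e, by simp,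
          hu, ⟨_, hmul hv hz⟩, hx, htk, hk, by simp [mul_assoc], by simpa using he⟩⟩
      · have hlt : idealCard (x * (q * t)) < k + 1 := lt_of_le_of_ne
          ((idealCard_mul_le_left _ _).trans hx.le) hk
        -- The block is represented by `d * y` and not by `x * q`, so the drop must be moved to `y *
        -- t`: if `y = y * t * a`, then `x * q = c * y` would also be recoverable from `x * q * t`.
        have hyt : idealCard (y * t) < k + 1 := by
          refine lt_of_le_of_ne ((idealCard_mul_le_left _ _).trans hy.le) fun heq => ?_
          obtain ⟨a, ha⟩ := exists_eq_mul_mul_of_idealCard_eq (heq.trans hy.symm)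
          have h1 : x * q = x * (q * t) * a := by
            rw [hc, ha, ← mul_assoc, ← mul_assoc, ← mul_assoc x, hc]
          have h2 : idealCard (x * q) ≤ idealCard (x * (q * t)) := by
            conv_lhs => rw [h1]
            exact idealCard_mul_le_left _ _
          omega
        refine ⟨pre ++ ((u ++ v) ++ z), [], by simp, hpre.snoc
          (hmono (hmul hd hz) (by omega)) ?_, .inl rfl⟩
        rw [mul_assoc]
        exact (idealCard_mul_le_right _ _).trans (by omega)

/-- Induction on the ideal size: each level is removed at the price of a cost depending only on `k`
and `n`, never on the number of factors. At size `0` only the empty word remains, since ideals are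
nonempty. -/
theorem exists_forall_factored (hone : ∀ n, R n [] 1)
    (hmono : ∀ {n m w x}, R n w x → n ≤ m → R m w x)
    (hmul : ∀ {n m w v x y}, R n w x → R m v y → R (n + m) (w ++ v) (x * y))
    (hblock : ∀ {n n' u v w x q y a b}, R n u x → R n' v q → R n w y →
      x = x * (q * y) * a → y = b * (x * (q * y)) → ∃ d, R (2 * n + 1) (u ++ (v ++ w)) (d * y))
    (k n : ℕ) : ∃ m, ∀ w, Factored R k n w → ∃ x, R m w x := by
  induction k generalizing n with
  | zero =>
    refine ⟨0, fun w hw => ?_⟩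
    cases hw with
    | nil => exact ⟨1, hone 0⟩
    | snoc _ _ h => exact absurd h (Nat.not_le.2 (idealCard_pos _))
  | succ k ih =>
    obtain ⟨m, hm⟩ := ih (3 * n + 1)
    refine ⟨m + (2 * n + 1), fun w hw => ?_⟩
    obtain ⟨u, v, rfl, hu, hv⟩ := hw.exists_block hone hmono hmul hblock
    obtain ⟨x, hx⟩ := hm u hu
    rcases hv with rfl | ⟨-, -, -, -, y, -, d, -, -, -, -, -, -, -, hd⟩
    · exact ⟨x, by simpa using hmono hx (by omega)⟩
    · exact ⟨_, hmul hx hd⟩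

end Grouping

/-! ### Monomials -/

/-- A monomial is a product of letters and of languages `B*`, given as the list of its factors. -/
abbrev Monomial (A : Type) : Type := List (A ⊕ Set A)

/-- The language of a monomial. -/
def Monomial.Mem {A : Type} : Monomial A → List A → Prop
  | [], w => w = []
  | Sum.inl a :: K, w => ∃ v, w = a :: v ∧ Monomial.Mem K v
  | Sum.inr B :: K, w => ∃ u v, w = u ++ v ∧ (∀ a ∈ u, a ∈ B) ∧ Monomial.Mem K v

theorem Monomial.mem_append {A : Type} {K K' : Monomial A} {w : List A} :
    Monomial.Mem (K ++ K') w ↔ ∃ u v, w = u ++ v ∧ Monomial.Mem K u ∧ Monomial.Mem K' v := by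
  induction K generalizing w with
  | nil => simp [Monomial.Mem]
  | cons f K ih =>
    cases f with
    | inl a =>
      simp only [List.cons_append, Monomial.Mem, ih]
      constructor
      · rintro ⟨_, rfl, u, v, rfl, hu, hv⟩
        exact ⟨a :: u, v, rfl, ⟨u, rfl, hu⟩, hv⟩
      · rintro ⟨_, v, rfl, ⟨u, rfl, hu⟩, hv⟩
        exact ⟨u ++ v, rfl, u, v, rfl, hu, hv⟩
    | inr B =>
      simp only [List.cons_append, Monomial.Mem, ih]
      constructor
      · rintro ⟨b, _, rfl, hb, u, v, rfl, hu, hv⟩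
        exact ⟨b ++ u, v, by simp, ⟨b, u, rfl, hb, hu⟩, hv⟩
      · rintro ⟨_, v, rfl, ⟨b, u, rfl, hb, hu⟩, hv⟩
        exact ⟨b, u ++ v, by simp, hb, u, v, rfl, hu, hv⟩

/-- The word `w` lies in a monomial of length at most `n`, all of whose words have runs in the right
component of `x` only, and the other components of `x` are those of `w`. -/
def HasMonomial {A σ τ : Type} (M : NFA A σ) (N : NFA A τ) (n : ℕ) (w : List A)
    (x : Profile A σ τ) : Prop :=
  M.Run w = x.left ∧ alph w = x.letters ∧ ∃ K : Monomial A, K.length ≤ n ∧ K.Mem w ∧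
    ∀ v, K.Mem v → ∀ p q, N.Run v p q → x.right p q

namespace HasMonomial

variable {A σ τ : Type} {M : NFA A σ} {N : NFA A τ}

theorem one (n : ℕ) : HasMonomial M N n [] 1 := by
  refine ⟨rfl, by simp [alph], [], by simp, rfl, ?_⟩
  rintro v rfl p q h
  exact h

theorem letter (a : A) : HasMonomial M N 1 [a] (Profile.ofLetter M N a) := by
  refine ⟨rfl, by ext; simp [Profile.ofLetter], [Sum.inl a], le_rfl, ⟨[], rfl, rfl⟩, ?_⟩
  rintro v ⟨_, rfl, rfl⟩ p q h
  exact h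

theorem mono {n m : ℕ} {w : List A} {x : Profile A σ τ} (h : HasMonomial M N n w x)
    (hnm : n ≤ m) : HasMonomial M N m w x := by
  obtain ⟨h1, h2, K, h3, h4⟩ := h
  exact ⟨h1, h2, K, h3.trans hnm, h4⟩

theorem mul {n m : ℕ} {w v : List A} {x y : Profile A σ τ} (h : HasMonomial M N n w x)
    (h' : HasMonomial M N m v y) : HasMonomial M N (n + m) (w ++ v) (x * y) := by
  obtain ⟨h1, h2, K, h3, h4, h5⟩ := h
  obtain ⟨k1, k2, K', k3, k4, k5⟩ := h'
  refine ⟨by rw [NFA.run_append, h1, k1]; rfl, by rw [alph_append, h2, k2]; rfl, K ++ K',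
    by simp; omega, Monomial.mem_append.2 ⟨w, v, rfl, h4, k4⟩, ?_⟩
  intro t ht p q hpq
  obtain ⟨t1, t2, rfl, ht1, ht2⟩ := Monomial.mem_append.1 ht
  rw [NFA.run_append] at hpq
  obtain ⟨r, hpr, hrq⟩ := hpq
  exact ⟨r, h5 t1 ht1 p r hpr, k5 t2 ht2 r q hrq⟩

/-- The words between the first and the last factor of a block may be replaced by all words over the
same alphabet. -/
theorem block [Finite A] [Finite σ] [Finite τ] {n n' : ℕ} {u v w : List A}
    {x q y a b : Profile A σ τ} (hq : Saturated M N q) (hxs : Saturated M N x)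
    (hy : Saturated M N y) (has : Saturated M N a) (hbs : Saturated M N b)
    (hu : HasMonomial M N n u x) (hv : HasMonomial M N n' v q) (hw : HasMonomial M N n w y)
    (ha : x = x * (q * y) * a) (hb : y = b * (x * (q * y))) :
    ∃ d, Saturated M N d ∧ HasMonomial M N (2 * n + 1) (u ++ (v ++ w)) (d * y) := by
  -- The idempotent power `F` of `q * y * a` fixes `x` from the right and contains all letters of `q
  -- * y`. It is the profile to be saturated.
  obtain ⟨j, hj⟩ := exists_pow_idempotent (q * y * a)
  have hxpow : ∀ i, x = x * (q * y * a) ^ i := by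
    intro i
    induction i with
    | zero => simp
    | succ i ih =>
      rw [pow_succ', ← mul_assoc, ← mul_assoc x, ← ha]
      exact ih
  have hpows : ∀ i, Saturated M N ((q * y * a) ^ i) := by
    intro i
    induction i with
    | zero => exact .one
    | succ i ih => rw [pow_succ]; exact ih.mul ((hq.mul hy).mul has)
  have hF := hpows (j + 1)
  have hxF := hxpow (j + 1)
  have hletters : (q * y).letters ⊆ ((q * y * a) ^ (j + 1)).letters := by
    rw [pow_succ', Profile.mul_letters]
    exact Set.subset_union_left.trans Set.subset_union_left
  generalize (q * y * a) ^ (j + 1) = F at hj hF hxF hletters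
  refine ⟨x * F.saturate N * q, (hxs.mul (hF.saturate hj)).mul hq, ?_⟩
  have hxFl : F.letters ⊆ x.letters := by
    rw [hxF]; exact Set.subset_union_right
  have hbx : (b * x).letters ⊆ F.letters := by
    refine Set.Subset.trans ?_ (Set.subset_union_right.trans hletters)
    conv_rhs => rw [hb, ← mul_assoc]
    exact Set.subset_union_left
  -- Both end factors expose a copy of `F`: `x = x * F`, and `y` contains one after `b * x`.
  have hyF : y = b * x * F * (q * y) := by
    rw [mul_assoc b, ← hxF, mul_assoc]; exact hb
  have hbxs : Saturated M N (b * x) := hbs.mul hxs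
  obtain ⟨u1, u2, K, u3, u4, u5⟩ := hu
  obtain ⟨v1, v2, _⟩ := hv
  obtain ⟨w1, w2, L, w3, w4, w5⟩ := hw
  refine ⟨?_, ?_, K ++ Sum.inr F.letters :: L, by simp; omega, ?_, ?_⟩
  · rw [NFA.run_append, NFA.run_append, u1, v1, w1]
    have : x.left = Relation.Comp x.left F.left := congrArg Profile.left hxF
    simp only [Profile.mul_left', Profile.saturate]
    rw [← this, Relation.comp_assoc]
  · rw [alph_append, alph_append, u2, v2, w2]
    simp only [Profile.mul_letters, Profile.saturate]
    rw [Set.union_eq_self_of_subset_right hxFl, Set.union_assoc]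
  · refine Monomial.mem_append.2 ⟨u, v ++ w, rfl, u4, v, w, rfl, ?_, w4⟩
    intro c hc
    exact hletters (Or.inl (v2 ▸ hc))
  · intro t ht p r hpr
    obtain ⟨t1, _, rfl, ht1, t2, t3, rfl, ht2, ht3⟩ := Monomial.mem_append.1 ht
    rw [NFA.run_append, NFA.run_append] at hpr
    obtain ⟨p1, h1, p2, h2, h3⟩ := hpr
    -- Between the two copies of `F`, the run reads `t2` and then passes through `b * x`; both stay
    -- within the alphabet of `F`, so the whole run is one of `x * F.saturate N * q * y`.
    have h1' := u5 t1 ht1 _ _ h1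
    rw [hxF] at h1'
    have h3' := w5 t3 ht3 _ _ h3
    rw [hyF] at h3'
    obtain ⟨s1, k1, k2⟩ := h1'
    obtain ⟨s2, ⟨s3, k3, k4⟩, s4, k5, k6⟩ := h3'
    refine ⟨s4, ⟨s2, ⟨s1, k1, p1, k2, s3, ?_, k4⟩, k5⟩, k6⟩
    exact NFA.Reach.trans ⟨t2, ht2, h2⟩ ((hbxs.right_le k3).mono hbx)

end HasMonomial

/-- Every word lies in a monomial of bounded length whose words are controlled by a saturated
profile of the word. -/
theorem exists_forall_hasMonomial {A σ τ : Type} [Finite A] [Finite σ] [Finite τ] (M : NFA A σ)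
    (N : NFA A τ) : ∃ n, ∀ w, ∃ x, Saturated M N x ∧ HasMonomial M N n w x := by
  -- Ideals are taken inside the submonoid of saturated profiles, so that the multipliers `a` and
  -- `b` obtained from equal ideals are saturated too.
  let S : Submonoid (Profile A σ τ) :=
    { carrier := {x | Saturated M N x}
      mul_mem' := fun h h' => h.mul h'
      one_mem' := .one }
  let R : ℕ → List A → S → Prop := fun n w x => HasMonomial M N n w x
  obtain ⟨n, hn⟩ := exists_forall_factored (R := R) (fun n => HasMonomial.one n)
    (fun h h' => HasMonomial.mono h h') (fun h h' => HasMonomial.mul h h')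
    (fun {n n' u v w x q y a b} hu hv hw ha hb => by
      obtain ⟨d, hd, h⟩ := HasMonomial.block q.2 x.2 y.2 a.2 b.2 hu hv hw
        (congrArg Subtype.val ha) (congrArg Subtype.val hb)
      exact ⟨⟨d, hd⟩, h⟩) (Nat.card S) 1
  refine ⟨n, fun w => ?_⟩
  -- A word is the product of its letters, each with a monomial of length one and an ideal no larger
  -- than the monoid.
  obtain ⟨x, hx⟩ := hn w (by
    induction w using List.reverseRecOn with
    | nil => exact .nil
    | append_singleton w a ih =>
      exact ih.snoc (x := ⟨_, Saturated.letter a⟩) (HasMonomial.letter a) (idealCard_le_card _))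
  exact ⟨x, x.2, hx⟩
open FirstOrder FirstOrder.Language

/-! ### Embeddings of sets of positions -/

/-- The function `f` embeds the set `Y` of positions of `w` into the positions of `w'`: it preserves
the order and the letters. -/
structure EmbedsOn {A : Type} (Y : Finset ℕ) (f : ℕ → ℕ) (w w' : List A) : Prop where
  lt : ∀ y ∈ Y, y < w.length
  strictMonoOn : StrictMonoOn f Y
  getElem? : ∀ y ∈ Y, w'[f y]? = w[y]?

/-- The embedding `f` of `X` has a partial inverse on every set that has at most `n` elements
besides the image of `X`. -/
def BackOn {A : Type} (n : ℕ) (X : Finset ℕ) (f : ℕ → ℕ) (w w' : List A) : Prop :=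
  ∀ Y : Finset ℕ, (∀ y ∈ Y, y < w'.length) → Y.card ≤ n →
    ∃ g, EmbedsOn (Y ∪ X.image f) g w' w ∧ ∀ x ∈ X, g (f x) = x

/-- Glue functions on positions along a concatenation. -/
def gluePos (l l' : ℕ) (f g : ℕ → ℕ) (y : ℕ) : ℕ := if y < l then f y else l' + g (y - l)

section Embeds

variable {A : Type}

theorem EmbedsOn.map_lt {Y : Finset ℕ} {f : ℕ → ℕ} {w w' : List A} (h : EmbedsOn Y f w w') {y : ℕ}
    (hy : y ∈ Y) : f y < w'.length := by
  have h1 := h.getElem? y hy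
  rw [List.getElem?_eq_getElem (h.lt y hy)] at h1
  exact (List.getElem?_eq_some_iff.1 h1).1

theorem EmbedsOn.mono {X Y : Finset ℕ} {f : ℕ → ℕ} {w w' : List A} (h : EmbedsOn Y f w w')
    (hX : X ⊆ Y) : EmbedsOn X f w w' :=
  ⟨fun y hy => h.lt y (hX hy), h.strictMonoOn.mono (by exact_mod_cast hX),
    fun y hy => h.getElem? y (hX hy)⟩

theorem EmbedsOn.empty (f : ℕ → ℕ) (w w' : List A) : EmbedsOn ∅ f w w' :=
  ⟨by simp, by simp [StrictMonoOn], by simp⟩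

theorem EmbedsOn.glue {Y Y₁ Y₂ : Finset ℕ} {f g : ℕ → ℕ} {u u' v v' : List A}
    (hf : EmbedsOn Y₁ f u u') (hg : EmbedsOn Y₂ g v v')
    (h₁ : ∀ y ∈ Y, y < u.length → y ∈ Y₁) (h₂ : ∀ y ∈ Y, u.length ≤ y → y - u.length ∈ Y₂) :
    EmbedsOn Y (gluePos u.length u'.length f g) (u ++ v) (u' ++ v') := by
  refine ⟨fun y hy => ?_, fun x hx y hy hxy => ?_, fun y hy => ?_⟩
  · rw [List.length_append]
    rcases Nat.lt_or_ge y u.length with h | h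
    · omega
    · have := hg.lt _ (h₂ y hy h)
      omega
  · have hx' : x ∈ Y := hx
    have hy' : y ∈ Y := hy
    unfold gluePos
    rcases Nat.lt_or_ge x u.length with h | h
    · rcases Nat.lt_or_ge y u.length with k | k
      · rw [if_pos h, if_pos k]
        exact hf.strictMonoOn (h₁ x hx' h) (h₁ y hy' k) hxy
      · rw [if_pos h, if_neg (by omega)]
        have := hf.map_lt (h₁ x hx' h)
        omega
    · rw [if_neg (by omega), if_neg (by omega)]
      have := hg.strictMonoOn (h₂ x hx' h) (h₂ y hy' (by omega)) (by omega)
      omega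
  · unfold gluePos
    rcases Nat.lt_or_ge y u.length with h | h
    · rw [if_pos h, List.getElem?_append_left (hf.map_lt (h₁ y hy h)),
        List.getElem?_append_left h, hf.getElem? y (h₁ y hy h)]
    · rw [if_neg (by omega), List.getElem?_append_right (by omega), List.getElem?_append_right h,
        Nat.add_sub_cancel_left, hg.getElem? _ (h₂ y hy h)]

/-- The letters at the positions in `Y` spell a subword of `w'` of length at most `n`; an occurrence
of it in `w` is the embedding. -/
theorem SubwordLE.exists_embedsOn {n : ℕ} {w w' : List A} (h : SubwordLE n w w') (Y : Finset ℕ)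
    (hY : ∀ y ∈ Y, y < w'.length) (hn : Y.card ≤ n) : ∃ g, EmbedsOn Y g w' w := by
  let e := Y.orderIsoOfFin rfl
  have he : ∀ i, (e i : ℕ) < w'.length := fun i => hY _ (e i).2
  let s : List A := List.ofFn fun i : Fin Y.card => w'[(e i : ℕ)]'(he i)
  have hlen : s.length = Y.card := List.length_ofFn
  have hsub : s.Sublist w' := by
    rw [List.sublist_iff_exists_fin_orderEmbedding_get_eq]
    refine ⟨OrderEmbedding.ofStrictMono (fun i => ⟨e (Fin.cast hlen i), he _⟩) ?_, ?_⟩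
    · intro i j hij
      have h1 : e (Fin.cast hlen i) < e (Fin.cast hlen j) := e.strictMono hij
      exact h1
    · intro i
      simp [s]
      rfl
  obtain ⟨g, hg⟩ := List.sublist_iff_exists_orderEmbedding_getElem?_eq.1
    (h s (hlen.le.trans hn) hsub)
  refine ⟨fun y => if hy : y ∈ Y then g (e.symm ⟨y, hy⟩) else 0, hY, ?_, ?_⟩
  · intro x hx y hy hxy
    have hx' : x ∈ Y := hx
    have hy' : y ∈ Y := hy
    simp only [hx', hy', dif_pos]
    refine g.strictMono ?_
    have : e.symm ⟨x, hx'⟩ < e.symm ⟨y, hy'⟩ := e.symm.strictMono hxy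
    exact this
  · intro y hy
    simp only [hy, dif_pos]
    rw [← hg, List.getElem?_eq_getElem (by rw [hlen]; exact (e.symm ⟨y, hy⟩).2),
      List.getElem?_eq_getElem (hY y hy)]
    simp [s]

theorem BackOn.mono {n m : ℕ} {X : Finset ℕ} {f : ℕ → ℕ} {w w' : List A} (h : BackOn n X f w w')
    (hm : m ≤ n) : BackOn m X f w w' := fun Y hY hc => h Y hY (hc.trans hm)

/-- Translates the recursive comparison of words into the two moves of a game: a map of the chosen
positions, then a map back that answers any further `n` positions. -/
theorem WordLE.exists_embedsOn {n m : ℕ} {w w' : List A} (h : WordLE n m w w') (X : Finset ℕ)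
    (hX : ∀ x ∈ X, x < w.length) (hm : X.card ≤ m) :
    ∃ f, EmbedsOn X f w w' ∧ BackOn n X f w w' := by
  induction m generalizing w w' X with
  | zero =>
    obtain rfl : X = ∅ := by simpa using hm
    refine ⟨id, EmbedsOn.empty _ _ _, fun Y hY hn => ?_⟩
    obtain ⟨g, hg⟩ := h.subwordLE.exists_embedsOn Y hY hn
    exact ⟨g, by simpa using hg, by simp⟩
  | succ m ih =>
    rcases X.eq_empty_or_nonempty with rfl | hne
    · refine ⟨id, EmbedsOn.empty _ _ _, fun Y hY hn => ?_⟩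
      obtain ⟨g, hg⟩ := h.subwordLE.exists_embedsOn Y hY hn
      exact ⟨g, by simpa using hg, by simp⟩
    -- The leftmost position of `X` plays the role of the position chosen in the recursive clause of
    -- `WordLE`; the others are shifted into the remainder `r`.
    set x := X.min' hne with hx
    have hxX : x ∈ X := X.min'_mem hne
    have hmin : ∀ y ∈ X, x ≤ y := fun y hy => X.min'_le y hy
    clear_value x
    obtain ⟨g, a, r, rfl, hgx⟩ : ∃ g a r, w = g ++ a :: r ∧ g.length = x := by
      refine ⟨w.take x, w[x]'(hX x hxX), w.drop (x + 1), ?_, ?_⟩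
      · rw [← List.drop_eq_getElem_cons, List.take_append_drop]
      · simp [(hX x hxX).le]
    obtain ⟨g', r', rfl, hgg, hrr⟩ := h.2 g a r rfl
    set Xr := (X.erase x).image fun y => y - (x + 1) with hXr
    have hXr_mem : ∀ y ∈ X, y ≠ x → y - x - 1 ∈ Xr := fun y hy hne =>
      Finset.mem_image.2 ⟨y, Finset.mem_erase.2 ⟨hne, hy⟩, by omega⟩
    obtain ⟨f, hf, hback⟩ := ih hrr Xr (by
      intro y hy
      obtain ⟨z, hz, rfl⟩ := Finset.mem_image.1 hy
      obtain ⟨hz1, hz2⟩ := Finset.mem_erase.1 hz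
      have h1 := hX z hz2
      have h2 := hmin z hz2
      simp only [List.length_append, List.length_cons] at h1
      omega) (by
      refine Finset.card_image_le.trans ?_
      rw [Finset.card_erase_of_mem hxX]
      omega)
    have hid : EmbedsOn {0} id [a] [a] :=
      ⟨by simp, by simp [StrictMonoOn], by simp⟩
    set F := gluePos g.length g'.length id (gluePos 1 1 id f) with hF
    have hFx : ∀ y ∈ X, y ≠ x → F y = g'.length + (1 + f (y - x - 1)) := by
      intro y hy hne
      have := hmin y hy
      rw [hF, gluePos, if_neg (by omega), gluePos, if_neg (by omega), hgx]
    have hFxx : F x = g'.length := by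
      rw [hF, gluePos, if_neg (by omega), gluePos, if_pos (by omega), hgx]
      simp
    refine ⟨F, ?_, fun Y hY hn => ?_⟩
    · refine EmbedsOn.glue (Y₁ := ∅) (Y₂ := X.image fun y => y - x) (EmbedsOn.empty _ _ _)
        (EmbedsOn.glue (u := [a]) (u' := [a]) hid hf ?_ ?_) ?_ ?_
      · intro y hy hy1
        simp only [List.length_singleton] at hy1
        simp; omega
      · intro y hy hy1
        obtain ⟨z, hz, rfl⟩ := Finset.mem_image.1 hy
        simp only [List.length_singleton] at hy1 ⊢
        exact hXr_mem z hz (by omega)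
      · intro y hy hlt
        have := hmin y hy
        omega
      · intro y hy _
        rw [hgx]
        exact Finset.mem_image_of_mem _ hy
    -- `Y` is cut at the image of `x`. Each side has at most `n` elements: the left one is answered
    -- by the subword comparison, the right one by induction.
    · obtain ⟨g₁, hg₁⟩ := hgg.exists_embedsOn (Y.filter (· < g'.length)) (by simp)
        ((Finset.card_filter_le _ _).trans hn)
      obtain ⟨g₂, hg₂, hinv⟩ := hback
        ((Y.filter (g'.length < ·)).image fun y => y - g'.length - 1) (by
          intro y hy
          obtain ⟨z, hz, rfl⟩ := Finset.mem_image.1 hy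
          obtain ⟨hz1, hz2⟩ := Finset.mem_filter.1 hz
          have := hY z hz1
          simp only [List.length_append, List.length_cons] at this
          omega) (Finset.card_image_le.trans ((Finset.card_filter_le _ _).trans hn))
      refine ⟨gluePos g'.length g.length g₁ (gluePos 1 1 id g₂), ?_, ?_⟩
      · have hmem : ∀ y ∈ Y ∪ X.image F, y ∈ Y ∨ y = g'.length ∨
            ∃ z ∈ X, z ≠ x ∧ y = g'.length + (1 + f (z - x - 1)) := by
          intro y hy
          rcases Finset.mem_union.1 hy with hy | hy
          · exact .inl hy
          · obtain ⟨z, hz, rfl⟩ := Finset.mem_image.1 hy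
            by_cases hne : z = x
            · exact .inr (.inl (hne ▸ hFxx))
            · exact .inr (.inr ⟨z, hz, hne, hFx z hz hne⟩)
        refine EmbedsOn.glue (Y₂ := ((Y ∪ X.image F).filter (g'.length ≤ ·)).image
          fun y => y - g'.length) hg₁ (EmbedsOn.glue (u := [a]) (u' := [a]) hid hg₂ ?_ ?_) ?_ ?_
        · intro y _ hy1
          simp only [List.length_singleton] at hy1
          simp; omega
        · intro y hy hy1
          obtain ⟨z, hz, rfl⟩ := Finset.mem_image.1 hy
          obtain ⟨hz1, hz2⟩ := Finset.mem_filter.1 hz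
          simp only [List.length_singleton] at hy1 ⊢
          rcases hmem z hz1 with h1 | rfl | ⟨t, ht, hne, rfl⟩
          · exact Finset.mem_union_left _
              (Finset.mem_image_of_mem _ (Finset.mem_filter.2 ⟨h1, by omega⟩))
          · omega
          · refine Finset.mem_union_right _ (Finset.mem_image.2 ⟨_, hXr_mem t ht hne, by omega⟩)
        · intro y hy hlt
          rcases hmem y hy with h1 | rfl | ⟨t, ht, hne, rfl⟩
          · exact Finset.mem_filter.2 ⟨h1, hlt⟩
          · omega
          · omega
        · intro y hy hle
          exact Finset.mem_image_of_mem _ (Finset.mem_filter.2 ⟨hy, hle⟩)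
      · intro y hy
        by_cases hne : y = x
        · subst hne
          rw [hFxx, gluePos, if_neg (by omega), gluePos, if_pos (by omega)]
          simp [hgx]
        · have := hmin y hy
          rw [hFx y hy hne, gluePos, if_neg (by omega), Nat.add_sub_cancel_left, gluePos,
            if_neg (by omega), Nat.add_sub_cancel_left, hinv _ (hXr_mem y hy hne)]
          omega

end Embeds

/-! ### Existential formulas -/

section Formulas

variable {A : Type}

attribute [local instance] wordStructure

theorem exists_eq_var {n : ℕ} (t : (wordSig A).Term (Empty ⊕ Fin n)) :
    ∃ i, t = Term.var (Sum.inr i) := by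
  cases t with
  | var x =>
    cases x with
    | inl e => exact e.elim
    | inr i => exact ⟨i, rfl⟩
  | func f => exact Empty.elim f

theorem EmbedsOn.realize_iff_of_isAtomic {n : ℕ} {φ : (wordSig A).BoundedFormula Empty n}
    (h : φ.IsAtomic) {w w' : List A} {Y : Finset ℕ} {f : ℕ → ℕ} (hf : EmbedsOn Y f w w')
    {v : Fin n → Fin w.length} {v' : Fin n → Fin w'.length} (hv : ∀ i, (v i : ℕ) ∈ Y)
    (hv' : ∀ i, (v' i : ℕ) = f (v i)) :
    φ.Realize default v ↔ φ.Realize default v' := by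
  cases h with
  | equal t₁ t₂ =>
    obtain ⟨i, rfl⟩ := exists_eq_var t₁
    obtain ⟨j, rfl⟩ := exists_eq_var t₂
    simp only [BoundedFormula.realize_bdEqual, Term.realize_var, Sum.elim_inr, Fin.ext_iff, hv']
    exact (hf.strictMonoOn.injOn.eq_iff (hv i) (hv j)).symm
  | rel R ts =>
    simp only [BoundedFormula.realize_rel]
    cases R with
    | letter a =>
      obtain ⟨i, hi⟩ := exists_eq_var (ts 0)
      change w.get ((ts 0).realize _) = a ↔ w'.get ((ts 0).realize _) = a
      simp only [hi, Term.realize_var, Sum.elim_inr, List.get_eq_getElem]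
      have h1 := hf.getElem? _ (hv i)
      rw [← hv' i, List.getElem?_eq_getElem (v' i).2, List.getElem?_eq_getElem (v i).2,
        Option.some_inj] at h1
      rw [h1]
    | lt =>
      obtain ⟨i, hi⟩ := exists_eq_var (ts 0)
      obtain ⟨j, hj⟩ := exists_eq_var (ts 1)
      change (ts 0).realize _ < (ts 1).realize _ ↔ (ts 0).realize _ < (ts 1).realize _
      simp only [hi, hj, Term.realize_var, Sum.elim_inr, Fin.lt_def, hv']
      exact (hf.strictMonoOn.lt_iff_lt (hv i) (hv j)).symm

theorem EmbedsOn.realize_iff_of_isQF {n : ℕ} {φ : (wordSig A).BoundedFormula Empty n}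
    (h : φ.IsQF) {w w' : List A} {Y : Finset ℕ} {f : ℕ → ℕ} (hf : EmbedsOn Y f w w')
    {v : Fin n → Fin w.length} {v' : Fin n → Fin w'.length} (hv : ∀ i, (v i : ℕ) ∈ Y)
    (hv' : ∀ i, (v' i : ℕ) = f (v i)) :
    φ.Realize default v ↔ φ.Realize default v' := by
  induction h with
  | falsum => exact Iff.rfl
  | of_isAtomic h => exact hf.realize_iff_of_isAtomic h hv hv'
  | imp _ _ ih₁ ih₂ => simp only [BoundedFormula.realize_imp, ih₁, ih₂]

theorem EmbedsOn.realize_iff_of_isSigma_zero {i n : ℕ} {φ : (wordSig A).BoundedFormula Empty n}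
    (h : IsSigma i φ) (hi : i = 0) {w w' : List A} {Y : Finset ℕ} {f : ℕ → ℕ}
    (hf : EmbedsOn Y f w w')
    {v : Fin n → Fin w.length} {v' : Fin n → Fin w'.length} (hv : ∀ i, (v i : ℕ) ∈ Y)
    (hv' : ∀ i, (v' i : ℕ) = f (v i)) :
    φ.Realize default v ↔ φ.Realize default v' := by
  induction h with
  | qf h => exact hf.realize_iff_of_isQF h hv hv'
  | not => omega
  | inf _ _ ih₁ ih₂ => simp only [BoundedFormula.realize_inf, ih₁ hi hv hv', ih₂ hi hv hv']
  | sup _ _ ih₁ ih₂ => simp only [BoundedFormula.realize_sup, ih₁ hi hv hv', ih₂ hi hv hv']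
  | ex => omega

/-- A true existential formula stays true in all words that contain a copy of the witnesses. -/
theorem IsSigma.exists_witnesses {i n : ℕ} {φ : (wordSig A).BoundedFormula Empty n}
    (h : IsSigma i φ) (hi : i = 1) : ∃ m : ℕ, ∀ (w : List A) (v : Fin n → Fin w.length),
    φ.Realize default v → ∃ Y : Finset ℕ, Y.card ≤ m ∧ (∀ y ∈ Y, y < w.length) ∧
      ∀ Y', Y ⊆ Y' → (∀ i, (v i : ℕ) ∈ Y') → ∀ (w' : List A) (f : ℕ → ℕ), EmbedsOn Y' f w w' →
      ∀ v' : Fin n → Fin w'.length, (∀ i, (v' i : ℕ) = f (v i)) → φ.Realize default v' := by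
  induction h with
  | qf h =>
    exact ⟨0, fun w v hv => ⟨∅, le_rfl, by simp, fun Y' _ hY w' f hf v' hv' =>
      (hf.realize_iff_of_isQF h hY hv').1 hv⟩⟩
  | not h _ =>
    refine ⟨0, fun w v hv => ⟨∅, le_rfl, by simp, fun Y' _ hY w' f hf v' hv' => ?_⟩⟩
    rw [BoundedFormula.realize_not] at hv ⊢
    rwa [← hf.realize_iff_of_isSigma_zero h (by omega) hY hv']
  | inf _ _ ih₁ ih₂ =>
    obtain ⟨m₁, h₁⟩ := ih₁ hi
    obtain ⟨m₂, h₂⟩ := ih₂ hi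
    refine ⟨m₁ + m₂, fun w v hv => ?_⟩
    rw [BoundedFormula.realize_inf] at hv
    obtain ⟨Y₁, k₁, l₁, n₁⟩ := h₁ w v hv.1
    obtain ⟨Y₂, k₂, l₂, n₂⟩ := h₂ w v hv.2
    refine ⟨Y₁ ∪ Y₂, (Finset.card_union_le _ _).trans (by omega), by grind,
      fun Y' hYY hY w' f hf v' hv' => BoundedFormula.realize_inf.2
        ⟨n₁ Y' (Finset.union_subset_left hYY) hY w' f hf v' hv',
          n₂ Y' (Finset.union_subset_right hYY) hY w' f hf v' hv'⟩⟩
  | sup _ _ ih₁ ih₂ =>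
    obtain ⟨m₁, h₁⟩ := ih₁ hi
    obtain ⟨m₂, h₂⟩ := ih₂ hi
    refine ⟨m₁ + m₂, fun w v hv => ?_⟩
    rw [BoundedFormula.realize_sup] at hv
    rcases hv with hv | hv
    · obtain ⟨Y₁, k₁, l₁, n₁⟩ := h₁ w v hv
      exact ⟨Y₁, by omega, l₁, fun Y' hYY hY w' f hf v' hv' => BoundedFormula.realize_sup.2
        (.inl (n₁ Y' hYY hY w' f hf v' hv'))⟩
    · obtain ⟨Y₂, k₂, l₂, n₂⟩ := h₂ w v hv
      exact ⟨Y₂, by omega, l₂, fun Y' hYY hY w' f hf v' hv' => BoundedFormula.realize_sup.2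
        (.inr (n₂ Y' hYY hY w' f hf v' hv'))⟩
  | @ex i n φ _ ih =>
    obtain ⟨m, hm⟩ := ih hi
    refine ⟨m + 1, fun w v hv => ?_⟩
    rw [BoundedFormula.realize_ex] at hv
    obtain ⟨a, ha⟩ := hv
    obtain ⟨Y, k, l, hY⟩ := hm w _ ha
    refine ⟨insert (a : ℕ) Y, (Finset.card_insert_le _ _).trans (by omega), ?_, ?_⟩
    · intro y hy
      rcases Finset.mem_insert.1 hy with rfl | hy
      · exact a.2
      · exact l y hy
    · intro Y' hYY hvY w' f hf v' hv'
      rw [Finset.insert_subset_iff] at hYY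
      rw [BoundedFormula.realize_ex]
      refine ⟨⟨f a, hf.map_lt hYY.1⟩, hY Y' hYY.2 ?_ w' f hf _ ?_⟩
      · intro i
        refine Fin.lastCases ?_ (fun i => ?_) i
        · simpa using hYY.1
        · simpa using hvY i
      · intro i
        refine Fin.lastCases ?_ (fun i => ?_) i
        · simp
        · simpa using hv' i

/-! ### `Σ₂` formulas -/

/-- Outer existential witnesses are carried forward by `f`, while counterexamples to the inner
universal part are carried back by `BackOn`. One number `m` bounds both the witnesses and the size
of the sets to be answered. -/
theorem IsSigma.exists_bound {i n : ℕ} {φ : (wordSig A).BoundedFormula Empty n}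
    (h : IsSigma i φ) (hi : i = 2) : ∃ m : ℕ, ∀ (w : List A) (v : Fin n → Fin w.length),
    φ.Realize default v → ∃ X : Finset ℕ, X.card ≤ m ∧ (∀ x ∈ X, x < w.length) ∧
      ∀ X', X ⊆ X' → (∀ i, (v i : ℕ) ∈ X') → ∀ (w' : List A) (f : ℕ → ℕ), EmbedsOn X' f w w' →
      BackOn m X' f w w' →
      ∀ v' : Fin n → Fin w'.length, (∀ i, (v' i : ℕ) = f (v i)) → φ.Realize default v' := by
  induction h with
  | qf h =>
    exact ⟨0, fun w v hv => ⟨∅, le_rfl, by simp, fun Y' _ hY w' f hf _ v' hv' =>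
      (hf.realize_iff_of_isQF h hY hv').1 hv⟩⟩
  | not h _ =>
    obtain ⟨m, hm⟩ := h.exists_witnesses (by omega)
    refine ⟨m, fun w v hv => ⟨∅, by simp, by simp, fun X' _ hX w' f hf hback v' hv' => ?_⟩⟩
    rw [BoundedFormula.realize_not] at hv ⊢
    intro hr
    -- If the negated `Σ₁` formula held in `w'`, its few witnesses would be pulled back to `w` by a
    -- map inverse to `f` on the parameters.
    obtain ⟨Y, k, l, hY⟩ := hm w' v' hr
    obtain ⟨g, hg, hinv⟩ := hback Y l k
    refine hv (hY _ Finset.subset_union_left (fun i => ?_) w g hg v fun i => ?_)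
    · rw [hv']
      exact Finset.mem_union_right _ (Finset.mem_image_of_mem _ (hX i))
    · rw [hv', hinv _ (hX i)]
  | inf _ _ ih₁ ih₂ =>
    obtain ⟨m₁, h₁⟩ := ih₁ hi
    obtain ⟨m₂, h₂⟩ := ih₂ hi
    refine ⟨m₁ + m₂, fun w v hv => ?_⟩
    rw [BoundedFormula.realize_inf] at hv
    obtain ⟨Y₁, k₁, l₁, n₁⟩ := h₁ w v hv.1
    obtain ⟨Y₂, k₂, l₂, n₂⟩ := h₂ w v hv.2
    refine ⟨Y₁ ∪ Y₂, (Finset.card_union_le _ _).trans (by omega), by grind,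
      fun Y' hYY hY w' f hf hb v' hv' => BoundedFormula.realize_inf.2
        ⟨n₁ Y' (Finset.union_subset_left hYY) hY w' f hf (hb.mono (by omega)) v' hv',
          n₂ Y' (Finset.union_subset_right hYY) hY w' f hf (hb.mono (by omega)) v' hv'⟩⟩
  | sup _ _ ih₁ ih₂ =>
    obtain ⟨m₁, h₁⟩ := ih₁ hi
    obtain ⟨m₂, h₂⟩ := ih₂ hi
    refine ⟨m₁ + m₂, fun w v hv => ?_⟩
    rw [BoundedFormula.realize_sup] at hv
    rcases hv with hv | hv
    · obtain ⟨Y₁, k₁, l₁, n₁⟩ := h₁ w v hv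
      exact ⟨Y₁, by omega, l₁, fun Y' hYY hY w' f hf hb v' hv' => BoundedFormula.realize_sup.2
        (.inl (n₁ Y' hYY hY w' f hf (hb.mono (by omega)) v' hv'))⟩
    · obtain ⟨Y₂, k₂, l₂, n₂⟩ := h₂ w v hv
      exact ⟨Y₂, by omega, l₂, fun Y' hYY hY w' f hf hb v' hv' => BoundedFormula.realize_sup.2
        (.inr (n₂ Y' hYY hY w' f hf (hb.mono (by omega)) v' hv'))⟩
  | @ex i n φ _ ih =>
    obtain ⟨m, hm⟩ := ih hi
    refine ⟨m + 1, fun w v hv => ?_⟩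
    rw [BoundedFormula.realize_ex] at hv
    obtain ⟨a, ha⟩ := hv
    obtain ⟨Y, k, l, hY⟩ := hm w _ ha
    refine ⟨insert (a : ℕ) Y, (Finset.card_insert_le _ _).trans (by omega), ?_, ?_⟩
    · intro y hy
      rcases Finset.mem_insert.1 hy with rfl | hy
      · exact a.2
      · exact l y hy
    · intro Y' hYY hvY w' f hf hb v' hv'
      rw [Finset.insert_subset_iff] at hYY
      rw [BoundedFormula.realize_ex]
      refine ⟨⟨f a, hf.map_lt hYY.1⟩, hY Y' hYY.2 ?_ w' f hf (hb.mono (by omega)) _ ?_⟩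
      · intro i
        refine Fin.lastCases ?_ (fun i => ?_) i
        · simpa using hYY.1
        · simpa using hvY i
      · intro i
        refine Fin.lastCases ?_ (fun i => ?_) i
        · simp
        · simpa using hv' i

/-- Every language definable in `Σ₂` is upwards closed for some `WordLE n n`. -/
theorem exists_wordLE_of_mem_sigmaClass {L : Language A} (hL : L ∈ SigmaClass A 2) :
    ∃ n, ∀ w w', WordLE n n w w' → w ∈ L → w' ∈ L := by
  obtain ⟨φ, hφ, rfl⟩ := hL
  obtain ⟨n, hn⟩ := hφ.exists_bound rfl
  refine ⟨n, fun w w' hww hw => ?_⟩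
  obtain ⟨X, h1, h2, h3⟩ := hn w default hw
  obtain ⟨f, hf, hback⟩ := hww.exists_embedsOn X h2 h1
  exact h3 X subset_rfl (fun i => i.elim0) w' f hf hback default (fun i => i.elim0)

end Formulas

/-! ### Monomials are `Σ₂`-definable -/

section MonomialFormulas

variable {A : Type}

attribute [local instance] wordStructure

/-- The formula `x_i < x_j`. -/
def ltFormula {k : ℕ} (i j : Fin k) : (wordSig A).BoundedFormula Empty k :=
  Relations.boundedFormula₂ (L := wordSig A) (WordRel.lt : WordRel A 2)
    (Term.var (Sum.inr i)) (Term.var (Sum.inr j))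

/-- The formula that says that the position `x_i` carries the letter `a`. -/
def letterFormula {k : ℕ} (a : A) (i : Fin k) : (wordSig A).BoundedFormula Empty k :=
  Relations.boundedFormula₁ (L := wordSig A) (WordRel.letter a : WordRel A 1)
    (Term.var (Sum.inr i))

theorem ltFormula_isQF {k : ℕ} (i j : Fin k) : (ltFormula (A := A) i j).IsQF :=
  (BoundedFormula.IsAtomic.rel _ _).isQF

theorem letterFormula_isQF {k : ℕ} (a : A) (i : Fin k) : (letterFormula a i).IsQF :=
  (BoundedFormula.IsAtomic.rel _ _).isQF

theorem realize_ltFormula {k : ℕ} (i j : Fin k) (w : List A) (v : Fin k → Fin w.length) :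
    (ltFormula (A := A) i j).Realize default v ↔ v i < v j :=
  BoundedFormula.realize_rel₂

theorem realize_letterFormula {k : ℕ} (a : A) (i : Fin k) (w : List A)
    (v : Fin k → Fin w.length) :
    (letterFormula a i).Realize default v ↔ w[(v i : ℕ)] = a :=
  BoundedFormula.realize_rel₁

theorem isQF_foldr_inf {k : ℕ} (l : List ((wordSig A).BoundedFormula Empty k))
    (h : ∀ φ ∈ l, φ.IsQF) : (l.foldr (· ⊓ ·) ⊤).IsQF := by
  induction l with
  | nil => exact BoundedFormula.IsQF.top
  | cons φ l ih => exact (h φ (by simp)).inf (ih fun ψ hψ => h ψ (by simp [hψ]))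

/-- The formula that says that the letter at the position `x_i` lies in `B`. -/
noncomputable def memFormula [Finite A] {k : ℕ} (B : Set A) (i : Fin k) :
    (wordSig A).BoundedFormula Empty k :=
  ((Set.toFinite Bᶜ).toFinset.toList.map fun a => (letterFormula a i).not).foldr (· ⊓ ·) ⊤

theorem memFormula_isQF [Finite A] {k : ℕ} (B : Set A) (i : Fin k) : (memFormula B i).IsQF := by
  refine isQF_foldr_inf _ fun φ hφ => ?_
  obtain ⟨a, -, rfl⟩ := List.mem_map.1 hφ
  exact (letterFormula_isQF a i).not

theorem realize_memFormula [Finite A] {k : ℕ} (B : Set A) (i : Fin k) (w : List A)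
    (v : Fin k → Fin w.length) :
    (memFormula B i).Realize default v ↔ w[(v i : ℕ)] ∈ B := by
  rw [memFormula, BoundedFormula.realize_foldr_inf]
  simp only [List.mem_map, Finset.mem_toList, Set.Finite.mem_toFinset, Set.mem_compl_iff,
    forall_exists_index, and_imp, forall_apply_eq_imp_iff₂, BoundedFormula.realize_not,
    realize_letterFormula]
  grind

/-- The position after the last one of the first `n` variables, and `0` if there are none. -/
def nextPos {l k : ℕ} (v : Fin k → Fin l) : (n : ℕ) → n ≤ k → ℕ
  | 0, _ => 0
  | m + 1, h => v ⟨m, h⟩ + 1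

/-- The formula that says that `x_j` is after the last one of the first `n` variables. -/
def afterFormula {k : ℕ} : (n : ℕ) → n ≤ k → Fin k → (wordSig A).BoundedFormula Empty k
  | 0, _, _ => ⊤
  | m + 1, h, j => ltFormula ⟨m, h⟩ j

theorem afterFormula_isQF {k : ℕ} (n : ℕ) (h : n ≤ k) (j : Fin k) :
    (afterFormula (A := A) n h j).IsQF := by
  cases n with
  | zero => exact BoundedFormula.IsQF.top
  | succ m => exact ltFormula_isQF _ _

theorem realize_afterFormula {k : ℕ} (n : ℕ) (h : n ≤ k) (j : Fin k) (w : List A)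
    (v : Fin k → Fin w.length) :
    (afterFormula (A := A) n h j).Realize default v ↔ nextPos v n h ≤ v j := by
  cases n with
  | zero => simp [afterFormula, nextPos]
  | succ m =>
    rw [afterFormula, realize_ltFormula, nextPos, Fin.lt_def]
    omega

theorem nextPos_snoc {l k : ℕ} (v : Fin k → Fin l) (a : Fin l) (n : ℕ) (h : n ≤ k) :
    nextPos (Fin.snoc (α := fun _ => Fin l) v a : Fin (k + 1) → Fin l) n (h.trans k.le_succ) =
      nextPos v n h := by
  cases n with
  | zero => rfl
  | succ m =>
    have : (⟨m, h.trans k.le_succ⟩ : Fin (k + 1)) = Fin.castSucc ⟨m, h⟩ := rfl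
    rw [nextPos, nextPos, this, Fin.snoc_castSucc]

theorem nextPos_snoc_self {l k : ℕ} (v : Fin k → Fin l) (a : Fin l) :
    nextPos (Fin.snoc (α := fun _ => Fin l) v a : Fin (k + 1) → Fin l) (k + 1) le_rfl = a + 1 := by
  have : (⟨k, k.lt_succ_self⟩ : Fin (k + 1)) = Fin.last k := rfl
  rw [nextPos, this, Fin.snoc_last]

/-- The formula that says that the factor after the last variable lies in the language of a
monomial. -/
noncomputable def Monomial.toFormula [Finite A] : (K : Monomial A) → (n : ℕ) →
    (wordSig A).BoundedFormula Empty n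
  | [], n => (afterFormula n n.le_succ (Fin.last n)).ex.not
  | Sum.inl a :: K, n =>
    (afterFormula n n.le_succ (Fin.last n) ⊓ letterFormula a (Fin.last n) ⊓
      (afterFormula n (n.le_succ.trans (n + 1).le_succ) (Fin.last (n + 1)) ⊓
        ltFormula (Fin.last (n + 1)) (Fin.castSucc (Fin.last n))).ex.not ⊓
      Monomial.toFormula K (n + 1)).ex
  | Sum.inr B :: K, n =>
    Monomial.toFormula K n ⊔
    (afterFormula n n.le_succ (Fin.last n) ⊓
      (afterFormula n (n.le_succ.trans (n + 1).le_succ) (Fin.last (n + 1)) ⊓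
        (ltFormula (Fin.castSucc (Fin.last n)) (Fin.last (n + 1))).not ⊓
        (memFormula B (Fin.last (n + 1))).not).ex.not ⊓
      Monomial.toFormula K (n + 1)).ex

theorem Monomial.isSigma_toFormula [Finite A] (K : Monomial A) (n : ℕ) :
    IsSigma 2 (Monomial.toFormula K n) := by
  induction K generalizing n with
  | nil => exact .not (.ex (.qf (afterFormula_isQF _ _ _)))
  | cons f K ih =>
    cases f with
    | inl a =>
      exact .ex (.inf (.inf (.qf ((afterFormula_isQF _ _ _).inf (letterFormula_isQF _ _)))
        (.not (.ex (.qf ((afterFormula_isQF _ _ _).inf (ltFormula_isQF _ _)))))) (ih _))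
    | inr B =>
      exact .sup (ih _) (.ex (.inf (.inf (.qf (afterFormula_isQF _ _ _))
        (.not (.ex (.qf (((afterFormula_isQF _ _ _).inf (ltFormula_isQF _ _).not).inf
          (memFormula_isQF _ _).not))))) (ih _)))

/-- Variables mark the letters of the monomial and the last letter of each nonempty `B*` factor. An
empty factor has no last letter, hence the separate disjunct. -/
theorem Monomial.realize_toFormula [Finite A] (K : Monomial A) (n : ℕ) (w : List A)
    (v : Fin n → Fin w.length) : (Monomial.toFormula K n).Realize default v ↔
      Monomial.Mem K (w.drop (nextPos v n le_rfl)) := by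
  induction K generalizing n with
  | nil =>
    simp only [Monomial.toFormula, Monomial.Mem, BoundedFormula.realize_not,
      BoundedFormula.realize_ex, realize_afterFormula, nextPos_snoc _ _ n le_rfl,
      Fin.snoc_last,
      List.drop_eq_nil_iff]
    generalize nextPos v n le_rfl = b
    constructor
    · intro h
      by_contra hb
      exact h ⟨⟨b, by omega⟩, le_rfl⟩
    · rintro h ⟨a, ha⟩
      have := a.2
      omega
  | cons f K ih =>
    cases f with
    | inl a =>
      simp only [Monomial.toFormula, Monomial.Mem, BoundedFormula.realize_not,
        BoundedFormula.realize_ex, BoundedFormula.realize_inf, realize_afterFormula,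
        realize_letterFormula, realize_ltFormula, nextPos_snoc _ _ n n.le_succ, ih,
        nextPos_snoc _ _ n le_rfl,
        nextPos_snoc_self, Fin.snoc_last, Fin.snoc_castSucc]
      generalize nextPos v n le_rfl = b
      constructor
      · rintro ⟨z, ⟨⟨hz, ha⟩, hno⟩, hK⟩
        have hb : b = z := by
          by_contra hne
          exact hno ⟨⟨b, by omega⟩, le_rfl, Fin.lt_def.2 (by simp only; omega)⟩
        subst hb
        exact ⟨_, by rw [List.drop_eq_getElem_cons z.2, ha], hK⟩
      · rintro ⟨u, hu, hK⟩
        have hb : b < w.length := by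
          by_contra hb
          rw [List.drop_eq_nil_of_le (by omega)] at hu
          simp at hu
        rw [List.drop_eq_getElem_cons hb, List.cons.injEq] at hu
        refine ⟨⟨b, hb⟩, ⟨⟨le_rfl, hu.1⟩, ?_⟩, hu.2 ▸ hK⟩
        rintro ⟨y, hy, hlt⟩
        rw [Fin.lt_def] at hlt
        simp only at hlt
        omega
    | inr B =>
      simp only [Monomial.toFormula, Monomial.Mem, BoundedFormula.realize_not,
        BoundedFormula.realize_ex, BoundedFormula.realize_inf, BoundedFormula.realize_sup,
        realize_afterFormula, realize_memFormula, realize_ltFormula,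
        nextPos_snoc _ _ n n.le_succ, ih,
        nextPos_snoc _ _ n le_rfl,
        nextPos_snoc_self, Fin.snoc_last, Fin.snoc_castSucc]
      generalize nextPos v n le_rfl = b
      constructor
      · rintro (h | ⟨z, ⟨hz, hno⟩, hK⟩)
        · exact ⟨[], _, rfl, by simp, h⟩
        · refine ⟨(w.drop b).take (z + 1 - b), w.drop (z + 1), ?_, ?_, hK⟩
          · conv_lhs => rw [← List.take_append_drop (z + 1 - b) (w.drop b)]
            rw [List.drop_drop, show b + (z + 1 - b) = z + 1 by omega]
          · intro a ha
            obtain ⟨i, hi, rfl⟩ := List.mem_iff_getElem.1 ha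
            simp only [List.length_take, List.length_drop] at hi
            by_contra hnot
            refine hno ⟨⟨b + i, by omega⟩, ⟨by simp, ?_⟩, ?_⟩
            · rw [Fin.lt_def]; simp only; omega
            · simpa using hnot
      · rintro ⟨u, t, hut, hu, hK⟩
        rcases u.eq_nil_or_concat with rfl | ⟨u', a, rfl⟩
        · rw [List.nil_append] at hut
          exact .inl (hut ▸ hK)
        · right
          have hlen := congrArg List.length hut
          simp only [List.length_drop, List.length_append, List.concat_eq_append,
            List.length_cons, List.length_nil] at hlen
          -- The marker is the position of the last letter of the `B*` factor.
          refine ⟨⟨b + u'.length, by omega⟩, ⟨by simp, ?_⟩, ?_⟩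
          · rintro ⟨y, ⟨hy, hlt⟩, hnot⟩
            rw [Fin.lt_def] at hlt
            simp only at hlt
            refine hnot (hu _ ?_)
            refine List.mem_iff_getElem.2 ⟨y - b, by simp; omega, ?_⟩
            have h1 : (w.drop b)[(y : ℕ) - b]? = some w[y] := by
              rw [List.getElem?_drop, show b + ((y : ℕ) - b) = y by omega]
              simp
            rw [hut, List.getElem?_append_left (by simp; omega)] at h1
            exact (List.getElem?_eq_some_iff.1 h1).2
          · have h1 : w.drop (b + u'.length + 1) = t := by
              rw [add_assoc, ← List.drop_drop, hut]
              exact List.drop_left' (by simp)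
            simpa [h1] using hK

/-- Finite unions of languages of monomials are definable in `Σ₂`. -/
theorem Monomial.union_mem_sigmaClass [Finite A] {s : Set (Monomial A)} (hs : s.Finite) :
    ({w | ∃ K ∈ s, Monomial.Mem K w} : Language A) ∈ SigmaClass A 2 := by
  induction s, hs using Set.Finite.induction_on with
  | empty =>
    refine ⟨⊥, .qf BoundedFormula.isQF_bot, ?_⟩
    ext w
    simp only [languageOf, Set.mem_empty_iff_false, false_and, exists_false]
    rfl
  | @insert K s _ _ ih =>
    obtain ⟨φ, hφ, h⟩ := ih
    refine ⟨Monomial.toFormula K 0 ⊔ φ, .sup (Monomial.isSigma_toFormula K 0) hφ, ?_⟩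
    ext w
    have h1 : (∃ K ∈ s, Monomial.Mem K w) ↔ w ∈ languageOf φ := by rw [← h]; rfl
    change (∃ K' ∈ insert K s, Monomial.Mem K' w) ↔
      BoundedFormula.Realize (Monomial.toFormula K 0 ⊔ φ) default default
    rw [BoundedFormula.realize_sup, Monomial.realize_toFormula]
    simp only [Set.mem_insert_iff, exists_eq_or_imp, h1, nextPos, List.drop_zero]
    rfl

end MonomialFormulas

/-! ### The characterization of separability -/

/-- The relation `r` leads from some initial state to some final state. -/
def NFA.AcceptsRel {A σ : Type} (M : NFA A σ) (r : σ → σ → Prop) : Prop :=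
  ∃ p ∈ M.start, ∃ q ∈ M.accept, r p q

/-- An accepting saturated profile yields `w` in the first language and `w'` in the second with `w`
below `w'`, which no `Σ₂` language separates. Otherwise the bounded monomials that avoid the second
language cover the first. -/
theorem separable_sigma_iff {A σ τ : Type} [Finite A] [Finite σ] [Finite τ] (M : NFA A σ)
    (N : NFA A τ) : Separable (SigmaClass A 2) M.accepts N.accepts ↔
      ¬ ∃ x, Saturated M N x ∧ M.AcceptsRel x.left ∧ N.AcceptsRel x.right := by
  constructor
  · rintro ⟨L, hL, h₁, h₂⟩ ⟨x, hx, ⟨p, hp, q, hq, hpq⟩, r, hr, s, hs, hrs⟩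
    obtain ⟨n, hn⟩ := exists_wordLE_of_mem_sigmaClass hL
    obtain ⟨w, hw, -, hw'⟩ := hx.exists_word n n
    obtain ⟨w', hww, hrun⟩ := hw' r s hrs
    refine h₂ w' ((N.mem_accepts_iff_run w').2 ⟨r, hr, s, hs, hrun⟩) (hn w w' hww (h₁ w ?_))
    exact (M.mem_accepts_iff_run w).2 ⟨p, hp, q, hq, hw ▸ hpq⟩
  · intro h
    obtain ⟨n, hn⟩ := exists_forall_hasMonomial M N
    let s : Set (Monomial A) := {K | K.length ≤ n ∧ ∀ v ∈ N.accepts, ¬ K.Mem v}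
    have hs : s.Finite := (List.finite_length_le (A ⊕ Set A) n).subset fun K hK => hK.1
    refine ⟨_, Monomial.union_mem_sigmaClass hs, fun w hw => ?_, ?_⟩
    · obtain ⟨x, hx, hleft, -, K, hlen, hK, hrun⟩ := hn w
      refine ⟨K, ⟨hlen, fun v hv hKv => h ⟨x, hx, ?_, ?_⟩⟩, hK⟩
      · rw [← hleft]
        exact (M.mem_accepts_iff_run w).1 hw
      · obtain ⟨p, hp, q, hq, hpq⟩ := (N.mem_accepts_iff_run v).1 hv
        exact ⟨p, hp, q, hq, hrun v hKv p q hpq⟩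
    · rintro v hv ⟨K, ⟨-, hK⟩, hKv⟩
      exact hK v hv hKv

/-- The complement of a separator separates in the other direction. -/
theorem separable_pi_iff {A : Type} (i : ℕ) (L₁ L₂ : Language A) :
    Separable (PiClass A i) L₁ L₂ ↔ Separable (SigmaClass A i) L₂ L₁ := by
  have hnot : ∀ (φ : (wordSig A).Sentence) (w : List A),
      w ∈ languageOf (BoundedFormula.not φ) ↔ w ∉ languageOf φ := fun φ w => Iff.rfl
  constructor
  · rintro ⟨_, ⟨_, ⟨φ, hφ, rfl⟩, rfl⟩, h₁, h₂⟩
    refine ⟨_, ⟨φ, hφ, rfl⟩, fun w hw => ?_, fun w hw => (hnot φ w).1 (h₁ w hw)⟩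
    have := h₂ w hw
    rw [hnot, not_not] at this
    exact this
  · rintro ⟨_, ⟨φ, hφ, rfl⟩, h₁, h₂⟩
    refine ⟨_, ⟨_, ⟨φ, hφ, rfl⟩, rfl⟩, fun w hw => (hnot φ w).2 (h₂ w hw), fun w hw => ?_⟩
    rw [hnot, not_not]
    exact h₁ w hw
-- Primitive recursive predicates and bounded quantifiers
theorem primrecPred_imp {α : Type} [Primcodable α] {P Q : α → Prop} (hP : PrimrecPred P)
    (hQ : PrimrecPred Q) : PrimrecPred fun a => P a → Q a :=
  (hP.not.or hQ).of_eq fun _ => imp_iff_not_or.symm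

theorem primrecPred_iff {α : Type} [Primcodable α] {P Q : α → Prop} (hP : PrimrecPred P)
    (hQ : PrimrecPred Q) : PrimrecPred fun a => P a ↔ Q a :=
  ((primrecPred_imp hP hQ).and (primrecPred_imp hQ hP)).of_eq fun _ => iff_iff_implies_and_implies.symm

theorem primrecPred_forall_lt {α : Type} [Primcodable α] {f : α → ℕ} {P : α → ℕ → Prop}
    (hf : Primrec f) (hP : PrimrecPred fun x : α × ℕ => P x.1 x.2) :
    PrimrecPred fun a => ∀ i < f a, P a i := by
  have h : PrimrecRel fun i a => P a i := hP.comp (Primrec.snd.pair Primrec.fst)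
  exact (h.forall_mem_list.comp (Primrec.list_range.comp hf) Primrec.id).of_eq (by simp)

theorem primrecPred_exists_lt {α : Type} [Primcodable α] {f : α → ℕ} {P : α → ℕ → Prop}
    (hf : Primrec f) (hP : PrimrecPred fun x : α × ℕ => P x.1 x.2) :
    PrimrecPred fun a => ∃ i < f a, P a i := by
  have h : PrimrecRel fun i a => P a i := hP.comp (Primrec.snd.pair Primrec.fst)
  exact (h.exists_mem_list.comp (Primrec.list_range.comp hf) Primrec.id).of_eq (by simp)

theorem primrecPred_mem_list {α β : Type} [Primcodable α] [Primcodable β] {f : α → List β}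
    {g : α → β} (hf : Primrec f) (hg : Primrec g) : PrimrecPred fun a => g a ∈ f a := by
  have h : PrimrecRel fun x y : β => x = y := Primrec.eq
  exact (h.exists_mem_list.comp hf hg).of_eq (by simp)

theorem primrec_two_pow {α : Type} [Primcodable α] {f : α → ℕ} (hf : Primrec f) :
    Primrec fun a => 2 ^ f a :=
  (Primrec₂.unpaired'.1 Nat.Primrec.pow).comp (Primrec.const 2) hf

/-! ### Numbers as sets and relations -/

/-- The `i`-th binary digit of `x` is one. -/
def HasBit (x i : ℕ) : Prop := x / 2 ^ i % 2 = 1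

theorem primrecPred_hasBit {α : Type} [Primcodable α] {f g : α → ℕ} (hf : Primrec f)
    (hg : Primrec g) : PrimrecPred fun a => HasBit (f a) (g a) :=
  Primrec.eq.comp (Primrec.nat_mod.comp (Primrec.nat_div.comp hf (primrec_two_pow hg))
    (Primrec.const 2)) (Primrec.const 1)

/-- Turns quantification over subsets of an initial segment into bounded quantification over
numbers. -/
theorem exists_hasBit_iff (b : ℕ) (P : ℕ → Prop) :
    ∃ x < 2 ^ b, ∀ i < b, HasBit x i ↔ P i := by
  classical
  refine ⟨Nat.ofBits fun i : Fin b => decide (P i), Nat.ofBits_lt_two_pow _, fun i hi => ?_⟩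
  have h := Nat.testBit_ofBits_lt (fun i : Fin b => decide (P i)) i hi
  rw [Nat.testBit_eq_decide_div_mod_eq, decide_eq_decide] at h
  exact h

/-- The relation with the code `x`. -/
def decodeRel (n x : ℕ) (i j : Fin n) : Prop := HasBit x (Nat.pair i j)

/-- The set with the code `x`. -/
def decodeSet (k x : ℕ) : Set (Fin k) := {a | HasBit x a}

theorem exists_decodeRel_eq {n : ℕ} (r : Fin n → Fin n → Prop) :
    ∃ x < 2 ^ Nat.pair n n, decodeRel n x = r := by
  obtain ⟨x, hx, h⟩ := exists_hasBit_iff (Nat.pair n n) fun t =>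
    ∃ i j : Fin n, t = Nat.pair i j ∧ r i j
  refine ⟨x, hx, ?_⟩
  funext i j
  have hlt : Nat.pair i j < Nat.pair n n :=
    (Nat.pair_lt_pair_left _ i.2).trans (Nat.pair_lt_pair_right _ j.2)
  rw [decodeRel, h _ hlt, eq_iff_iff]
  constructor
  · rintro ⟨i', j', h1, h2⟩
    rw [Nat.pair_eq_pair] at h1
    rwa [Fin.ext h1.1, Fin.ext h1.2]
  · exact fun h => ⟨i, j, rfl, h⟩

theorem exists_decodeSet_eq {k : ℕ} (B : Set (Fin k)) : ∃ x < 2 ^ k, decodeSet k x = B := by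
  obtain ⟨x, hx, h⟩ := exists_hasBit_iff k fun t => ∃ a : Fin k, t = a ∧ a ∈ B
  refine ⟨x, hx, ?_⟩
  ext a
  rw [decodeSet, Set.mem_ofPred_eq, h _ a.2]
  constructor
  · rintro ⟨b, h1, h2⟩
    rwa [Fin.ext h1]
  · exact fun h => ⟨a, rfl, h⟩

/-- `z` is a code of the composition of the relations with the codes `x` and `y`. -/
def IsCompCode (n x y z : ℕ) : Prop := ∀ i < n, ∀ j < n,
  HasBit z (Nat.pair i j) ↔ ∃ l < n, HasBit x (Nat.pair i l) ∧ HasBit y (Nat.pair l j)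

/-- `x` is a code of the identity. -/
def IsIdCode (n x : ℕ) : Prop := ∀ i < n, ∀ j < n, HasBit x (Nat.pair i j) ↔ i = j

/-- `x` is a code of the transitions of an automaton with the letter `a`. -/
def IsStepCode (c : NFACode) (a x : ℕ) : Prop := ∀ i < c.1, ∀ j < c.1,
  HasBit x (Nat.pair i j) ↔ (i, a, j) ∈ c.2.1

/-- The state `q` is reachable from `p` with letters from the set with the code `B`. -/
def ReachCode (k : ℕ) (c : NFACode) (B p q : ℕ) : Prop := ∀ C < 2 ^ c.1, HasBit C p →
  (∀ u < c.1, ∀ v < c.1, ∀ a < k, HasBit C u → HasBit B a → (u, a, v) ∈ c.2.1 → HasBit C v) →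
  HasBit C q

/-- `y` is a code of the relation with the code `x`, saturated with the words over the set with the
code `B`. -/
def IsSaturateCode (k : ℕ) (c : NFACode) (B x y : ℕ) : Prop := ∀ i < c.1, ∀ j < c.1,
  HasBit y (Nat.pair i j) ↔ ∃ u < c.1, HasBit x (Nat.pair i u) ∧
    ∃ v < c.1, ReachCode k c B u v ∧ HasBit x (Nat.pair v j)

/-- The relation with the code `x` leads from an initial state to a final state. -/
def AcceptsCode (c : NFACode) (x : ℕ) : Prop := ∃ i < c.1, ∃ j < c.1,
  i ∈ c.2.2.1 ∧ j ∈ c.2.2.2 ∧ HasBit x (Nat.pair i j)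

theorem isCompCode_iff {n x y z : ℕ} : IsCompCode n x y z ↔
    decodeRel n z = Relation.Comp (decodeRel n x) (decodeRel n y) := by
  simp only [IsCompCode, funext_iff, decodeRel, Relation.Comp, eq_iff_iff, Fin.forall_iff,
    Fin.exists_iff, exists_prop]

theorem isIdCode_iff {n x : ℕ} : IsIdCode n x ↔ decodeRel n x = Eq := by
  simp only [IsIdCode, funext_iff, decodeRel, eq_iff_iff, Fin.forall_iff, Fin.mk.injEq]

theorem isStepCode_iff {k : ℕ} {c : NFACode} {a : Fin k} {x : ℕ} :
    IsStepCode c a x ↔ decodeRel c.1 x = (c.toNFA k).Run [a] := by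
  simp only [IsStepCode, funext_iff, decodeRel, eq_iff_iff, NFA.Run, Fin.forall_iff,
    NFACode.toNFA, Set.mem_ofPred_eq, exists_eq_right]

/-- The set of states reachable from `p` is itself closed and has a code below the bound;
conversely, every closed set containing `p` contains the states along any run. -/
theorem reachCode_iff {k : ℕ} {c : NFACode} {B : ℕ} {p q : Fin c.1} :
    ReachCode k c B p q ↔ (c.toNFA k).Reach (decodeSet k B) p q := by
  constructor
  · intro h
    obtain ⟨C, hC, hbit⟩ := exists_decodeSet_eq {v | (c.toNFA k).Reach (decodeSet k B) p v}
    have hmem : ∀ v : Fin c.1, HasBit C v ↔ (c.toNFA k).Reach (decodeSet k B) p v := by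
      intro v
      rw [Set.ext_iff] at hbit
      exact hbit v
    rw [← hmem]
    refine h C hC ((hmem p).2 ⟨[], by simp, rfl⟩) fun u hu v hv a ha hCu hBa hstep => ?_
    refine (hmem ⟨v, hv⟩).2 (((hmem ⟨u, hu⟩).1 hCu).trans ⟨[⟨a, ha⟩], ?_, ?_⟩)
    · simpa [decodeSet] using hBa
    · exact ⟨⟨v, hv⟩, hstep, rfl⟩
  · rintro ⟨w, hw, hrun⟩ C - hp hclosed
    induction w generalizing p with
    | nil =>
      obtain rfl : p = q := hrun
      exact hp
    | cons a w ih =>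
      obtain ⟨r, hr, hrun⟩ := hrun
      exact ih (fun b hb => hw b (by simp [hb])) hrun
        (hclosed p p.2 r r.2 a a.2 hp (hw a (by simp)) hr)

theorem isSaturateCode_iff {k : ℕ} {c : NFACode} {B x y : ℕ} : IsSaturateCode k c B x y ↔
    decodeRel c.1 y = Relation.Comp (decodeRel c.1 x)
      (Relation.Comp ((c.toNFA k).Reach (decodeSet k B)) (decodeRel c.1 x)) := by
  simp only [IsSaturateCode, funext_iff, decodeRel, Relation.Comp, eq_iff_iff, ← reachCode_iff,
    Fin.forall_iff, Fin.exists_iff, exists_prop]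

theorem acceptsCode_iff {k : ℕ} {c : NFACode} {x : ℕ} :
    AcceptsCode c x ↔ (c.toNFA k).AcceptsRel (decodeRel c.1 x) := by
  simp only [AcceptsCode, NFA.AcceptsRel, decodeRel, NFACode.toNFA, Set.mem_ofPred_eq,
    Fin.exists_iff, exists_prop]
  grind

/-! ### Primitive recursiveness of the predicates on relation codes -/

section Primrec

open Primrec

variable {α : Type} [Primcodable α]

theorem primrecPred_isCompCode {n x y z : α → ℕ} (hn : Primrec n) (hx : Primrec x)
    (hy : Primrec y) (hz : Primrec z) :
    PrimrecPred fun a => IsCompCode (n a) (x a) (y a) (z a) := by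
  unfold IsCompCode
  -- Under nested quantifiers the argument is a left-nested tuple: `snd` is the innermost bound
  -- variable and each `fst` strips one quantifier.
  refine primrecPred_forall_lt hn (primrecPred_forall_lt (hn.comp fst) (primrecPred_iff
    (primrecPred_hasBit (hz.comp (fst.comp fst)) (Primrec₂.natPair.comp (snd.comp fst) snd))
    (primrecPred_exists_lt (hn.comp (fst.comp fst)) (.and
      (primrecPred_hasBit (hx.comp (fst.comp (fst.comp fst)))
        (Primrec₂.natPair.comp (snd.comp (fst.comp fst)) snd))
      (primrecPred_hasBit (hy.comp (fst.comp (fst.comp fst)))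
        (Primrec₂.natPair.comp snd (snd.comp fst)))))))

theorem primrecPred_isIdCode {n x : α → ℕ} (hn : Primrec n) (hx : Primrec x) :
    PrimrecPred fun a => IsIdCode (n a) (x a) := by
  unfold IsIdCode
  exact primrecPred_forall_lt hn (primrecPred_forall_lt (hn.comp fst) (primrecPred_iff
    (primrecPred_hasBit (hx.comp (fst.comp fst)) (Primrec₂.natPair.comp (snd.comp fst) snd))
    (Primrec.eq.comp (snd.comp fst) snd)))

theorem primrecPred_isStepCode {c : α → NFACode} {l x : α → ℕ} (hc : Primrec c)
    (hl : Primrec l) (hx : Primrec x) : PrimrecPred fun a => IsStepCode (c a) (l a) (x a) := by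
  unfold IsStepCode
  have hn : Primrec fun a => (c a).1 := fst.comp hc
  exact primrecPred_forall_lt hn (primrecPred_forall_lt (hn.comp fst) (primrecPred_iff
    (primrecPred_hasBit (hx.comp (fst.comp fst)) (Primrec₂.natPair.comp (snd.comp fst) snd))
    (primrecPred_mem_list (fst.comp (snd.comp (hc.comp (fst.comp fst))))
      ((snd.comp fst).pair ((hl.comp (fst.comp fst)).pair snd)))))

theorem primrecPred_reachCode {k : α → ℕ} {c : α → NFACode} {B p q : α → ℕ} (hk : Primrec k)
    (hc : Primrec c) (hB : Primrec B) (hp : Primrec p) (hq : Primrec q) :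
    PrimrecPred fun a => ReachCode (k a) (c a) (B a) (p a) (q a) := by
  unfold ReachCode
  have hn : Primrec fun a => (c a).1 := fst.comp hc
  refine primrecPred_forall_lt (primrec_two_pow hn) (primrecPred_imp
    (primrecPred_hasBit snd (hp.comp fst)) (primrecPred_imp
    (primrecPred_forall_lt (hn.comp fst) (primrecPred_forall_lt (hn.comp (fst.comp fst))
    (primrecPred_forall_lt (hk.comp (fst.comp (fst.comp fst))) (primrecPred_imp
      (primrecPred_hasBit (snd.comp (fst.comp (fst.comp fst))) (snd.comp (fst.comp fst)))
      (primrecPred_imp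
        (primrecPred_hasBit (hB.comp (fst.comp (fst.comp (fst.comp fst)))) snd)
        (primrecPred_imp
          (primrecPred_mem_list (fst.comp (snd.comp (hc.comp (fst.comp (fst.comp (fst.comp fst))))))
            ((snd.comp (fst.comp fst)).pair (snd.pair (snd.comp fst))))
          (primrecPred_hasBit (snd.comp (fst.comp (fst.comp fst))) (snd.comp fst))))))))
    (primrecPred_hasBit snd (hq.comp fst))))

theorem primrecPred_isSaturateCode {k : α → ℕ} {c : α → NFACode} {B x y : α → ℕ}
    (hk : Primrec k) (hc : Primrec c) (hB : Primrec B) (hx : Primrec x) (hy : Primrec y) :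
    PrimrecPred fun a => IsSaturateCode (k a) (c a) (B a) (x a) (y a) := by
  unfold IsSaturateCode
  have hn : Primrec fun a => (c a).1 := fst.comp hc
  have π₃ : Primrec fun t : ((α × ℕ) × ℕ) × ℕ => t.1.1.1 := fst.comp (fst.comp fst)
  have π₄ : Primrec fun t : (((α × ℕ) × ℕ) × ℕ) × ℕ => t.1.1.1.1 := π₃.comp fst
  refine primrecPred_forall_lt hn (primrecPred_forall_lt (hn.comp fst) (primrecPred_iff
    (primrecPred_hasBit (hy.comp (fst.comp fst)) (Primrec₂.natPair.comp (snd.comp fst) snd))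
    (primrecPred_exists_lt (hn.comp (fst.comp fst)) (.and
      (primrecPred_hasBit (hx.comp π₃) (Primrec₂.natPair.comp (snd.comp (fst.comp fst)) snd))
      (primrecPred_exists_lt (hn.comp π₃) (.and
        (primrecPred_reachCode (hk.comp π₄) (hc.comp π₄) (hB.comp π₄) (snd.comp fst) snd)
        (primrecPred_hasBit (hx.comp π₄) (Primrec₂.natPair.comp snd (snd.comp (fst.comp fst))))))))))

theorem primrecPred_acceptsCode {c : α → NFACode} {x : α → ℕ} (hc : Primrec c) (hx : Primrec x) :
    PrimrecPred fun a => AcceptsCode (c a) (x a) := by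
  unfold AcceptsCode
  have hn : Primrec fun a => (c a).1 := fst.comp hc
  refine primrecPred_exists_lt hn (primrecPred_exists_lt (hn.comp fst) (.and
    (primrecPred_mem_list (fst.comp (snd.comp (snd.comp (hc.comp (fst.comp fst)))))
      (snd.comp fst))
    (.and (primrecPred_mem_list (snd.comp (snd.comp (snd.comp (hc.comp (fst.comp fst))))) snd)
      (primrecPred_hasBit (hx.comp (fst.comp fst)) (Primrec₂.natPair.comp (snd.comp fst) snd)))))

end Primrec

/-! ### Codes of profiles -/

/-- The code of the left component. -/
def leftCode (t : ℕ) : ℕ := t.unpair.1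

/-- The code of the set of letters. -/
def lettersCode (t : ℕ) : ℕ := t.unpair.2.unpair.1

/-- The code of the right component. -/
def rightCode (t : ℕ) : ℕ := t.unpair.2.unpair.2

theorem primrec_leftCode : Primrec leftCode := Primrec.fst.comp Primrec.unpair

theorem primrec_lettersCode : Primrec lettersCode :=
  Primrec.fst.comp (Primrec.unpair.comp (Primrec.snd.comp Primrec.unpair))

theorem primrec_rightCode : Primrec rightCode :=
  Primrec.snd.comp (Primrec.unpair.comp (Primrec.snd.comp Primrec.unpair))

/-- The profile with the code `t`. -/
def decodeProfile (k n m t : ℕ) : Profile (Fin k) (Fin n) (Fin m) :=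
  ⟨decodeRel n (leftCode t), decodeSet k (lettersCode t), decodeRel m (rightCode t)⟩

/-- Every profile has a code below this bound. -/
def codeBound (k n m : ℕ) : ℕ :=
  Nat.pair (2 ^ Nat.pair n n) (Nat.pair (2 ^ k) (2 ^ Nat.pair m m))

theorem exists_decodeProfile_eq {k n m : ℕ} (x : Profile (Fin k) (Fin n) (Fin m)) :
    ∃ t < codeBound k n m, decodeProfile k n m t = x := by
  obtain ⟨l, hl, hl'⟩ := exists_decodeRel_eq x.left
  obtain ⟨B, hB, hB'⟩ := exists_decodeSet_eq x.letters
  obtain ⟨r, hr, hr'⟩ := exists_decodeRel_eq x.right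
  refine ⟨Nat.pair l (Nat.pair B r), ?_, ?_⟩
  · exact (Nat.pair_lt_pair_left _ hl).trans (Nat.pair_lt_pair_right _
      ((Nat.pair_lt_pair_left _ hB).trans (Nat.pair_lt_pair_right _ hr)))
  · ext1 <;> simpa [decodeProfile, leftCode, lettersCode, rightCode]

theorem decodeProfile_eq_iff {k n m t : ℕ} {x : Profile (Fin k) (Fin n) (Fin m)} :
    decodeProfile k n m t = x ↔ decodeRel n (leftCode t) = x.left ∧
      decodeSet k (lettersCode t) = x.letters ∧ decodeRel m (rightCode t) = x.right := by
  rw [Profile.ext_iff]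
  rfl

/-- `t` is a code of the unit. -/
def IsOneCode (k n m t : ℕ) : Prop :=
  IsIdCode n (leftCode t) ∧ (∀ a < k, ¬ HasBit (lettersCode t) a) ∧ IsIdCode m (rightCode t)

/-- `t` is a code of the profile of the letter `a`. -/
def IsLetterCode (k : ℕ) (c d : NFACode) (a t : ℕ) : Prop :=
  IsStepCode c a (leftCode t) ∧ (∀ b < k, HasBit (lettersCode t) b ↔ b = a) ∧
    IsStepCode d a (rightCode t)

/-- `t` is a code of the product of the profiles with the codes `r` and `s`. -/
def IsMulCode (k n m r s t : ℕ) : Prop :=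
  IsCompCode n (leftCode r) (leftCode s) (leftCode t) ∧
  (∀ a < k, HasBit (lettersCode t) a ↔ HasBit (lettersCode r) a ∨ HasBit (lettersCode s) a) ∧
  IsCompCode m (rightCode r) (rightCode s) (rightCode t)

/-- `t` is a code of the saturation of the profile with the code `s`. -/
def IsSaturateProfileCode (k n : ℕ) (d : NFACode) (s t : ℕ) : Prop :=
  (∀ i < n, ∀ j < n, HasBit (leftCode t) (Nat.pair i j) ↔ HasBit (leftCode s) (Nat.pair i j)) ∧
  (∀ a < k, HasBit (lettersCode t) a ↔ HasBit (lettersCode s) a) ∧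
  IsSaturateCode k d (lettersCode s) (rightCode s) (rightCode t)

theorem isOneCode_iff {k n m t : ℕ} : IsOneCode k n m t ↔ decodeProfile k n m t = 1 := by
  rw [decodeProfile_eq_iff, IsOneCode, isIdCode_iff, isIdCode_iff]
  simp [decodeSet, Set.ext_iff, Fin.forall_iff]

theorem isLetterCode_iff {k : ℕ} {c d : NFACode} {a : Fin k} {t : ℕ} : IsLetterCode k c d a t ↔
    decodeProfile k c.1 d.1 t = Profile.ofLetter (c.toNFA k) (d.toNFA k) a := by
  rw [decodeProfile_eq_iff, IsLetterCode, isStepCode_iff (k := k), isStepCode_iff (k := k)]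
  simp [decodeSet, Set.ext_iff, Fin.forall_iff, Profile.ofLetter, Fin.ext_iff]

theorem isMulCode_iff {k n m r s t : ℕ} : IsMulCode k n m r s t ↔
    decodeProfile k n m t = decodeProfile k n m r * decodeProfile k n m s := by
  rw [decodeProfile_eq_iff, IsMulCode, isCompCode_iff, isCompCode_iff]
  simp [decodeSet, Set.ext_iff, Fin.forall_iff, decodeProfile]

theorem isSaturateProfileCode_iff {k n : ℕ} {d : NFACode} {s t : ℕ} :
    IsSaturateProfileCode k n d s t ↔
      decodeProfile k n d.1 t = (decodeProfile k n d.1 s).saturate (d.toNFA k) := by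
  rw [decodeProfile_eq_iff, IsSaturateProfileCode, isSaturateCode_iff]
  simp [decodeSet, Set.ext_iff, Fin.forall_iff, decodeProfile, Profile.saturate, funext_iff,
    decodeRel]

/-- The set of profiles with the code `S` is closed under the rules of `Saturated`. -/
def ClosedCode (k : ℕ) (c d : NFACode) (S : ℕ) : Prop :=
  (∀ t < codeBound k c.1 d.1, IsOneCode k c.1 d.1 t → HasBit S t) ∧
  (∀ t < codeBound k c.1 d.1, ∀ a < k, IsLetterCode k c d a t → HasBit S t) ∧
  (∀ t < codeBound k c.1 d.1, ∀ r < codeBound k c.1 d.1, ∀ s < codeBound k c.1 d.1,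
    HasBit S r → HasBit S s → IsMulCode k c.1 d.1 r s t → HasBit S t) ∧
  (∀ t < codeBound k c.1 d.1, ∀ s < codeBound k c.1 d.1,
    HasBit S s → IsMulCode k c.1 d.1 s s s → IsSaturateProfileCode k c.1 d s t → HasBit S t)

/-- Codes are not unique, as irrelevant digits are free. Therefore the induction shows that all
codes of `x` below the bound belong to the closed set. -/
theorem ClosedCode.hasBit {k : ℕ} {c d : NFACode} {S : ℕ} (h : ClosedCode k c d S)
    {x : Profile (Fin k) (Fin c.1) (Fin d.1)} (hx : Saturated (c.toNFA k) (d.toNFA k) x) :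
    ∀ t < codeBound k c.1 d.1, decodeProfile k c.1 d.1 t = x → HasBit S t := by
  obtain ⟨h₁, h₂, h₃, h₄⟩ := h
  induction hx with
  | one => exact fun t ht hd => h₁ t ht (isOneCode_iff.2 hd)
  | letter a => exact fun t ht hd => h₂ t ht a a.2 (isLetterCode_iff.2 hd)
  | @mul x y _ _ ihx ihy =>
    intro t ht hd
    obtain ⟨r, hr, rfl⟩ := exists_decodeProfile_eq x
    obtain ⟨s, hs, rfl⟩ := exists_decodeProfile_eq y
    exact h₃ t ht r hr s hs (ihx r hr rfl) (ihy s hs rfl) (isMulCode_iff.2 hd)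
  | @saturate x _ hidem ih =>
    intro t ht hd
    obtain ⟨s, hs, rfl⟩ := exists_decodeProfile_eq x
    exact h₄ t ht s hs (ih s hs rfl) (isMulCode_iff.2 hidem.symm)
      (isSaturateProfileCode_iff.2 hd)

/-- Every set of codes of profiles that is closed under the rules of `Saturated` has a member both
components of which are accepting. -/
def InseparableCode (k : ℕ) (c d : NFACode) : Prop :=
  ∀ S < 2 ^ codeBound k c.1 d.1, ClosedCode k c d S →
    ∃ t < codeBound k c.1 d.1, HasBit S t ∧ AcceptsCode c (leftCode t) ∧ AcceptsCode d (rightCode t)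

/-- A least fixed point is the intersection of all closed sets, so no iteration is needed: the set
of all codes of saturated profiles is one of the closed sets, and it lies in every other. -/
theorem inseparableCode_iff {k : ℕ} {c d : NFACode} : InseparableCode k c d ↔
    ∃ x, Saturated (c.toNFA k) (d.toNFA k) x ∧ (c.toNFA k).AcceptsRel x.left ∧
      (d.toNFA k).AcceptsRel x.right := by
  constructor
  · intro h
    obtain ⟨S, hS, hbit⟩ := exists_hasBit_iff (codeBound k c.1 d.1) fun t =>
      Saturated (c.toNFA k) (d.toNFA k) (decodeProfile k c.1 d.1 t)
    have hclosed : ClosedCode k c d S := by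
      refine ⟨fun t ht h1 => ?_, fun t ht a ha h1 => ?_, fun t ht r hr s hs h1 h2 h3 => ?_,
        fun t ht s hs h1 h2 h3 => ?_⟩
      · rw [hbit t ht, isOneCode_iff.1 h1]
        exact .one
      · rw [hbit t ht, isLetterCode_iff (a := ⟨a, ha⟩) |>.1 h1]
        exact .letter _
      · rw [hbit t ht, isMulCode_iff.1 h3]
        exact .mul ((hbit r hr).1 h1) ((hbit s hs).1 h2)
      · rw [hbit t ht, isSaturateProfileCode_iff.1 h3]
        exact .saturate ((hbit s hs).1 h1) (isMulCode_iff.1 h2).symm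
    obtain ⟨t, ht, hSt, hc, hd⟩ := h S hS hclosed
    exact ⟨_, (hbit t ht).1 hSt, acceptsCode_iff.1 hc, acceptsCode_iff.1 hd⟩
  · rintro ⟨x, hx, hc, hd⟩ S - hS
    obtain ⟨t, ht, rfl⟩ := exists_decodeProfile_eq x
    exact ⟨t, ht, hS.hasBit hx t ht rfl, acceptsCode_iff.2 hc, acceptsCode_iff.2 hd⟩

/-! ### Primitive recursiveness of the separability criterion -/

section Primrec

open Primrec

variable {α : Type} [Primcodable α]

theorem primrec_codeBound {k n m : α → ℕ} (hk : Primrec k) (hn : Primrec n) (hm : Primrec m) :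
    Primrec fun a => codeBound (k a) (n a) (m a) :=
  Primrec₂.natPair.comp (primrec_two_pow (Primrec₂.natPair.comp hn hn))
    (Primrec₂.natPair.comp (primrec_two_pow hk) (primrec_two_pow (Primrec₂.natPair.comp hm hm)))

theorem primrecPred_isOneCode {k n m t : α → ℕ} (hk : Primrec k) (hn : Primrec n)
    (hm : Primrec m) (ht : Primrec t) :
    PrimrecPred fun a => IsOneCode (k a) (n a) (m a) (t a) := by
  unfold IsOneCode
  exact (primrecPred_isIdCode hn (primrec_leftCode.comp ht)).and (.and
    (primrecPred_forall_lt hk (primrecPred_hasBit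
      (primrec_lettersCode.comp (ht.comp fst)) snd).not)
    (primrecPred_isIdCode hm (primrec_rightCode.comp ht)))

theorem primrecPred_isLetterCode {k l t : α → ℕ} {c d : α → NFACode} (hk : Primrec k)
    (hc : Primrec c) (hd : Primrec d) (hl : Primrec l) (ht : Primrec t) :
    PrimrecPred fun a => IsLetterCode (k a) (c a) (d a) (l a) (t a) := by
  unfold IsLetterCode
  exact (primrecPred_isStepCode hc hl (primrec_leftCode.comp ht)).and (.and
    (primrecPred_forall_lt hk (primrecPred_iff (primrecPred_hasBit
      (primrec_lettersCode.comp (ht.comp fst)) snd) (Primrec.eq.comp snd (hl.comp fst))))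
    (primrecPred_isStepCode hd hl (primrec_rightCode.comp ht)))

theorem primrecPred_isMulCode {k n m r s t : α → ℕ} (hk : Primrec k) (hn : Primrec n)
    (hm : Primrec m) (hr : Primrec r) (hs : Primrec s) (ht : Primrec t) :
    PrimrecPred fun a => IsMulCode (k a) (n a) (m a) (r a) (s a) (t a) := by
  unfold IsMulCode
  exact (primrecPred_isCompCode hn (primrec_leftCode.comp hr) (primrec_leftCode.comp hs)
      (primrec_leftCode.comp ht)).and (.and
    (primrecPred_forall_lt hk (primrecPred_iff
      (primrecPred_hasBit (primrec_lettersCode.comp (ht.comp fst)) snd)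
      ((primrecPred_hasBit (primrec_lettersCode.comp (hr.comp fst)) snd).or
        (primrecPred_hasBit (primrec_lettersCode.comp (hs.comp fst)) snd))))
    (primrecPred_isCompCode hm (primrec_rightCode.comp hr) (primrec_rightCode.comp hs)
      (primrec_rightCode.comp ht)))

theorem primrecPred_isSaturateProfileCode {k n s t : α → ℕ} {d : α → NFACode} (hk : Primrec k)
    (hn : Primrec n) (hd : Primrec d) (hs : Primrec s) (ht : Primrec t) :
    PrimrecPred fun a => IsSaturateProfileCode (k a) (n a) (d a) (s a) (t a) := by
  unfold IsSaturateProfileCode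
  exact (primrecPred_forall_lt hn (primrecPred_forall_lt (hn.comp fst) (primrecPred_iff
      (primrecPred_hasBit (primrec_leftCode.comp (ht.comp (fst.comp fst)))
        (Primrec₂.natPair.comp (snd.comp fst) snd))
      (primrecPred_hasBit (primrec_leftCode.comp (hs.comp (fst.comp fst)))
        (Primrec₂.natPair.comp (snd.comp fst) snd))))).and (.and
    (primrecPred_forall_lt hk (primrecPred_iff
      (primrecPred_hasBit (primrec_lettersCode.comp (ht.comp fst)) snd)
      (primrecPred_hasBit (primrec_lettersCode.comp (hs.comp fst)) snd)))
    (primrecPred_isSaturateCode hk hd (primrec_lettersCode.comp hs) (primrec_rightCode.comp hs)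
      (primrec_rightCode.comp ht)))

theorem primrecPred_closedCode {k S : α → ℕ} {c d : α → NFACode} (hk : Primrec k)
    (hc : Primrec c) (hd : Primrec d) (hS : Primrec S) :
    PrimrecPred fun a => ClosedCode (k a) (c a) (d a) (S a) := by
  unfold ClosedCode
  have hn : Primrec fun a => (c a).1 := fst.comp hc
  have hm : Primrec fun a => (d a).1 := fst.comp hd
  have hb := primrec_codeBound hk hn hm
  have π₂ : Primrec fun t : (α × ℕ) × ℕ => t.1.1 := fst.comp fst
  have π₃ : Primrec fun t : ((α × ℕ) × ℕ) × ℕ => t.1.1.1 := π₂.comp fst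
  refine .and (primrecPred_forall_lt hb (primrecPred_imp
      (primrecPred_isOneCode (hk.comp fst) (hn.comp fst) (hm.comp fst) snd)
      (primrecPred_hasBit (hS.comp fst) snd)))
    (.and (primrecPred_forall_lt hb (primrecPred_forall_lt (hk.comp fst) (primrecPred_imp
      (primrecPred_isLetterCode (hk.comp π₂) (hc.comp π₂) (hd.comp π₂) snd (snd.comp fst))
      (primrecPred_hasBit (hS.comp π₂) (snd.comp fst)))))
    (.and (primrecPred_forall_lt hb (primrecPred_forall_lt (hb.comp fst)
      (primrecPred_forall_lt (hb.comp π₂) (primrecPred_imp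
        (primrecPred_hasBit (hS.comp π₃) (snd.comp fst)) (primrecPred_imp
          (primrecPred_hasBit (hS.comp π₃) snd) (primrecPred_imp
            (primrecPred_isMulCode (hk.comp π₃) (hn.comp π₃) (hm.comp π₃) (snd.comp fst) snd
              (snd.comp (fst.comp fst)))
            (primrecPred_hasBit (hS.comp π₃) (snd.comp (fst.comp fst)))))))))
    (primrecPred_forall_lt hb (primrecPred_forall_lt (hb.comp fst) (primrecPred_imp
        (primrecPred_hasBit (hS.comp π₂) snd) (primrecPred_imp
          (primrecPred_isMulCode (hk.comp π₂) (hn.comp π₂) (hm.comp π₂) snd snd snd)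
          (primrecPred_imp
            (primrecPred_isSaturateProfileCode (hk.comp π₂) (hn.comp π₂) (hd.comp π₂) snd
              (snd.comp fst))
            (primrecPred_hasBit (hS.comp π₂) (snd.comp fst)))))))))

theorem primrecPred_inseparableCode {k : α → ℕ} {c d : α → NFACode} (hk : Primrec k)
    (hc : Primrec c) (hd : Primrec d) :
    PrimrecPred fun a => InseparableCode (k a) (c a) (d a) := by
  unfold InseparableCode
  have hb := primrec_codeBound hk (fst.comp hc) (fst.comp hd)
  have π₂ : Primrec fun t : (α × ℕ) × ℕ => t.1.1 := fst.comp fst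
  exact primrecPred_forall_lt (primrec_two_pow hb) (primrecPred_imp
    (primrecPred_closedCode (hk.comp fst) (hc.comp fst) (hd.comp fst) snd)
    (primrecPred_exists_lt (hb.comp fst) (.and (primrecPred_hasBit (snd.comp fst) snd) (.and
      (primrecPred_acceptsCode (hc.comp π₂) (primrec_leftCode.comp snd))
      (primrecPred_acceptsCode (hd.comp π₂) (primrec_rightCode.comp snd))))))

theorem computablePred_separable_sigma {k : α → ℕ} {c d : α → NFACode} (hk : Primrec k)
    (hc : Primrec c) (hd : Primrec d) : ComputablePred fun a =>
      Separable (SigmaClass (Fin (k a)) 2) (NFACode.language (k a) (c a))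
        (NFACode.language (k a) (d a)) := by
  refine ComputablePred.of_eq (primrecPred_inseparableCode hk hc hd).not.computablePred fun a => ?_
  rw [inseparableCode_iff]
  exact (separable_sigma_iff _ _).symm

end Primrec

/-- There are algorithms that, given a number `k` and two nondeterministic finite automata over the
alphabet `{0, …, k - 1}`, with languages `L₁` and `L₂`, decide whether `L₁` is `Σ₂(<)`-separable
from `L₂`, and whether `L₁` is `Π₂(<)`-separable from `L₂`. -/
theorem corollary1 :
    ComputablePred (fun p : ℕ × NFACode × NFACode =>
      Separable (SigmaClass (Fin p.1) 2)
        (NFACode.language p.1 p.2.1) (NFACode.language p.1 p.2.2)) ∧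
    ComputablePred (fun p : ℕ × NFACode × NFACode =>
      Separable (PiClass (Fin p.1) 2)
        (NFACode.language p.1 p.2.1) (NFACode.language p.1 p.2.2)) := by
  have hc : Primrec fun p : ℕ × NFACode × NFACode => p.2.1 := Primrec.fst.comp Primrec.snd
  have hd : Primrec fun p : ℕ × NFACode × NFACode => p.2.2 := Primrec.snd.comp Primrec.snd
  -- For `Π₂` the two automata are exchanged.
  exact ⟨computablePred_separable_sigma Primrec.fst hc hd,
    (computablePred_separable_sigma Primrec.fst hd hc).of_eq fun _ =>
      (separable_pi_iff 2 _ _).symm⟩
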